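/- Let $\mathcal G$ be an undirected weighted graph with $n$ vertices, given by a symmetric weighted adjacency matrix $W_{\mathcal G}\in\mathbb R^{n\times n}$ with nonnegative entries and positive degrees; let $D$ be the diagonal degree matrix, $L=I-D^{-1/2}W_{\mathcal G}D^{-1/2}$ the normalized Laplacian, and $L=U\Sigma U^\top$ an eigendecomposition with $U=(\mathbf u_1,\dots,\mathbf u_n)$ orthogonal and $\Sigma=\mathrm{diag}(\sigma_1,\dots,\sigma_n)$, $\sigma_1\le\dots\le\sigma_n$. Let $\Delta t>0$, $A=\exp(-\Delta t L)$, $\lambda_i=\exp(-\Delta t\,\sigma_i)$, $1\le k\le n$, $T\ge 1$, $U_k=(\mathbf u_1,\dots,\mathbf u_k)$, $f_T(\lambda)=\big(\sum_{t=0}^{T-1}\lambda^{2t}\big)^{1/2}$ and $\pi_{A,T}(\mathbf x)=(\mathbf x,A\mathbf x,\dots,A^{T-1}\mathbf x)\in\mathbb R^{Tn}$, whose coordinates are indexed by the space-time nodes $(t,i)$, $0\le t<T$, $1\le i\le n$. Let $\widetilde U\in\mathbb R^{Tn\times k}$ be the matrix with entries $\widetilde U((t,i),\ell)=\lambda_\ell^{t}\,U(i,\ell)/f_T(\lambda_\ell)$.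 Consider one of three sampling regimes; all the probability distributions are entrywise positive, and all draws are independent (with replacement). 1. $\mathbf p$ is a distribution on $\{1,\dots,n\}$, and $\omega_1,\dots,\omega_m$ are drawn from $\mathbf p$. The sampled nodes are $(t,\omega_i)$ for $0\le t<T$, $1\le i\le m$, so the number of samples is $M=Tm$; the sample $(t,\omega_i)$ has probability $\mathbf p(\omega_i)$ and weight $1/m$. Put $\nu=\max_i \mathbf p(i)^{-1/2}\,\big\|(\widetilde U((t,i),\ell))_{0\le t<T,\,1\le \ell\le k}\big\|_2$ (operator norm). 2. For each $0\le t<T$, $\mathbf p_t$ is a distribution on $\{1,\dots,n\}$, and $\omega_{t,1},\dots,\omega_{t,m_t}$ are drawn from $\mathbf p_t$. The sampled nodes are $(t,\omega_{t,i})$, $M=\sum_t m_t$; the sample $(t,\omega_{t,i})$ has probability $\mathbf p_t(\omega_{t,i})$ and weight $1/m_t$. Put $\nu(t)=\max_i \mathbf p_t(i)^{-1/2}\,\|\widetilde U((t,i),\cdot)\|_2$. 3. $\mathbf p$ is a distribution on the space-time nodes, and the sampled nodes $\omega_1,\dots,\omega_m$ are drawn from $\mathbf p$, $M=m$; the sample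 $\omega_i$ has probability $\mathbf p(\omega_i)$ and weight $1/m$. Put $\nu=\max_{(t,i)} \mathbf p(t,i)^{-1/2}\,\|\widetilde U((t,i),\cdot)\|_2$. Let $S\in\{0,1\}^{M\times Tn}$ be the matrix that reads off the coordinates at the sampled nodes, and let $P$ and $W$ be the $M\times M$ diagonal matrices of the probabilities and of the weights of the samples. Let $\varepsilon,\delta\in(0,1)$ and suppose that $m\ge \frac{3}{\delta^2}\nu^2\log\frac{2k}{\varepsilon}$ in regimes 1 and 3, and $m_t\ge\frac{3}{\delta^2}\nu(t)^2\log\frac{2k}{\varepsilon}$ for all $0\le t<T$ in regime 2. Then, in each regime, with probability at least $1-\varepsilon$ the following holds for all $\mathbf x\in\mathrm{span}(U_k)$. (i) For all $\mathbf e\in\mathbb R^M$, the problem of minimizing $\|P^{-1/2}W^{1/2}(S\pi_{A,T}(\widetilde{\mathbf x})-\mathbf y)\|_2$ over $\widetilde{\mathbf x}\in\mathrm{span}(U_k)$ with $\mathbf y=S\pi_{A,T}(\mathbf x)+\mathbf e$ has a unique solution $\mathbf x^*$, and $$\|\mathbf x^*-\mathbf x\|_2\le\frac{2}{\sqrt{1-\delta}\,f_T(\lambda_k)}\,\|P^{-1/2}W^{1/2}\mathbf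 e\|_2 .$$ (ii) There is a nonzero $\mathbf e_0\in\mathbb R^M$ such that the solution $\mathbf x^*$ of the same problem with $\mathbf y=S\pi_{A,T}(\mathbf x)+\mathbf e_0$ satisfies $$\|\mathbf x^*-\mathbf x\|_2\ge\frac{1}{\sqrt{1+\delta}\,f_T(\lambda_1)}\,\|P^{-1/2}W^{1/2}\mathbf e_0\|_2 .$$ -/

import Mathlib

open MeasureTheory ProbabilityTheory
open scoped Matrix

namespace DynSampling

noncomputable section

/-- An undirected weighted graph on the vertices `0, …, n-1`, given by its symmetric weighted
adjacency matrix with nonnegative entries; the edges are the pairs with nonzero weight. -/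
structure WeightedGraph (n : ℕ) where
  weight : Matrix (Fin n) (Fin n) ℝ
  symm : weight.IsSymm
  nonneg : ∀ i j, 0 ≤ weight i j

namespace WeightedGraph

variable {n : ℕ} (G : WeightedGraph n)

/-- The degree of a vertex: the sum of the weights of its edges. -/
def deg (i : Fin n) : ℝ := ∑ j, G.weight i j

/-- The matrix `D^{-1/2}`, where `D` is the diagonal matrix of (positive) degrees. -/
def invSqrtDeg : Matrix (Fin n) (Fin n) ℝ := Matrix.diagonal fun i => (√(G.deg i))⁻¹

/-- The normalized diffusion operator `N = D^{-1/2} W D^{-1/2}`. -/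
def diffusion : Matrix (Fin n) (Fin n) ℝ := G.invSqrtDeg * G.weight * G.invSqrtDeg

/-- The normalized graph Laplacian `L = I - N`. -/
def laplacian : Matrix (Fin n) (Fin n) ℝ := 1 - G.diffusion

/-- The evolution operator `A = exp(-Δt L)` of the heat diffusion over one time step. -/
def evolution (Δt : ℝ) : Matrix (Fin n) (Fin n) ℝ := NormedSpace.exp (-Δt • G.laplacian)

end WeightedGraph

/-- `L = U diag(σ) Uᵀ` with orthonormal columns of `U` and eigenvalues in increasing order. -/
structure IsEigenDecomposition {n : ℕ} (L U : Matrix (Fin n) (Fin n) ℝ) (σ : Fin n → ℝ) :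
    Prop where
  orthogonal : U ∈ Matrix.orthogonalGroup (Fin n) ℝ
  monotone : Monotone σ
  decomp : L = U * Matrix.diagonal σ * Uᵀ

/-- The eigenvalues `λ_i = exp(-Δt σ_i)` of the evolution operator. -/
def evolEigenvalue {n : ℕ} (Δt : ℝ) (σ : Fin n → ℝ) (i : Fin n) : ℝ := Real.exp (-Δt * σ i)

/-- The matrix `U_k` of the first `k` columns of `U`. -/
def firstCols {n k : ℕ} (hkn : k ≤ n) (U : Matrix (Fin n) (Fin n) ℝ) :
    Matrix (Fin n) (Fin k) ℝ :=
  U.submatrix id (Fin.castLE hkn)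

/-- The space `span(U_k)` of `k`-bandlimited signals. -/
def bandlimited {n k : ℕ} (hkn : k ≤ n) (U : Matrix (Fin n) (Fin n) ℝ) :
    Submodule ℝ (Fin n → ℝ) :=
  Submodule.span ℝ (Set.range (firstCols hkn U).col)

/-- `f_T(λ) = (∑_{t=0}^{T-1} λ^{2t})^{1/2}`. -/
def fT (T : ℕ) (l : ℝ) : ℝ := √(∑ t ∈ Finset.range T, l ^ (2 * t))

/-- The Euclidean norm of a finite real vector. -/
def l2norm {ι : Type*} [Fintype ι] (v : ι → ℝ) : ℝ := ‖WithLp.toLp 2 v‖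

open scoped Matrix.Norms.L2Operator in
/-- The operator norm of a real matrix with respect to the Euclidean norms. -/
def opNorm {ι κ : Type*} [Fintype ι] [Fintype κ] [DecidableEq κ] (B : Matrix ι κ ℝ) : ℝ := ‖B‖

/-- The space-time field `π_{A,T}(x) = (x, A x, …, A^{T-1} x)`. The space-time node `i + tn` is
represented by the pair `(t, i)`. -/
def diffusionField {n : ℕ} (A : Matrix (Fin n) (Fin n) ℝ) (T : ℕ) (x : Fin n → ℝ) :
    Fin T × Fin n → ℝ :=
  fun q => ((A ^ (q.1 : ℕ)) *ᵥ x) q.2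

/-- The matrix `Ũ_{k,T}` whose column `ℓ` is the stack of `(λ_ℓ^t / f_T(λ_ℓ)) u_ℓ`,
`t = 0, …, T-1`. -/
def spaceTimeBasis {n k : ℕ} (hkn : k ≤ n) (T : ℕ) (Δt : ℝ) (U : Matrix (Fin n) (Fin n) ℝ)
    (σ : Fin n → ℝ) : Matrix (Fin T × Fin n) (Fin k) ℝ :=
  Matrix.of fun q l =>
    evolEigenvalue Δt σ (Fin.castLE hkn l) ^ (q.1 : ℕ) /
      fT T (evolEigenvalue Δt σ (Fin.castLE hkn l)) * firstCols hkn U q.2 l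

/-- A non-degenerate probability distribution on a finite set. -/
structure IsPosDistribution {ι : Type*} [Fintype ι] (p : ι → ℝ) : Prop where
  pos : ∀ i, 0 < p i
  sum_eq_one : ∑ i, p i = 1

/-- The spectral graph weighted coherence for random spatial locations at the initial time:
the maximum over the vertices `i` of the operator norm of the rows `(t, i)`, `t = 0, …, T-1`,
divided by the square root of `p i`. -/
def coherence₁ {n k T : ℕ} (V : Matrix (Fin T × Fin n) (Fin k) ℝ) (p : Fin n → ℝ) : ℝ :=
  ⨆ i : Fin n, 1 / √(p i) * opNorm (V.submatrix (fun t : Fin T => (t, i)) id)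

/-- The spectral graph weighted coherence at time `t` for random spatial locations at
consecutive times. -/
def coherence₂ {n k T : ℕ} (V : Matrix (Fin T × Fin n) (Fin k) ℝ) (p : Fin T → Fin n → ℝ)
    (t : Fin T) : ℝ :=
  ⨆ i : Fin n, 1 / √(p t i) * l2norm (Vᵀ *ᵥ Pi.single (t, i) 1)

/-- The spectral graph weighted coherence for random space-time locations. -/
def coherence₃ {n k T : ℕ} (V : Matrix (Fin T × Fin n) (Fin k) ℝ) (p : Fin T × Fin n → ℝ) : ℝ :=
  ⨆ q : Fin T × Fin n, 1 / √(p q) * l2norm (Vᵀ *ᵥ Pi.single q 1)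

/-- The random variables `ω j` are independent and `ω j` has the law `p j`:
`ℙ(ω j = i) = p j i`. -/
structure IsIndependentDraw {Ω ι κ : Type*} [MeasurableSpace Ω] [MeasurableSpace κ]
    (μ : Measure Ω) (p : ι → κ → ℝ) (ω : ι → Ω → κ) : Prop where
  measurable : ∀ j, Measurable (ω j)
  indep : iIndepFun ω μ
  law : ∀ j i, μ.real (ω j ⁻¹' {i}) = p j i

/-- The 0-1 sampling matrix whose row `r` has its single one in the column `loc r`. -/
def samplingMatrix {M N : Type*} [DecidableEq N] (loc : M → N) : Matrix M N ℝ :=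
  Matrix.of fun r c => if c = loc r then 1 else 0

/-- The sampling matrix `S₁ = diag(S₁⁽⁰⁾; …; S₁⁽⁰⁾)`: the vertices `ω i` are sampled at all
times. -/
def samplingMatrix₁ {n m : ℕ} (T : ℕ) (ω : Fin m → Fin n) :
    Matrix (Fin T × Fin m) (Fin T × Fin n) ℝ :=
  samplingMatrix fun r => (r.1, ω r.2)

/-- The sampling matrix `S₂ = diag(S₂⁽⁰⁾; …; S₂⁽ᵀ⁻¹⁾)`: the vertices `ω ⟨t, i⟩`, `i < m t`, are
sampled at the time `t`. -/
def samplingMatrix₂ {n T : ℕ} {m : Fin T → ℕ} (ω : (Σ t, Fin (m t)) → Fin n) :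
    Matrix (Σ t, Fin (m t)) (Fin T × Fin n) ℝ :=
  samplingMatrix fun r => (r.1, ω r)

/-- The sampling matrix `S₃`: the space-time nodes `ω i` are sampled. -/
def samplingMatrix₃ {n T m : ℕ} (ω : Fin m → Fin T × Fin n) :
    Matrix (Fin m) (Fin T × Fin n) ℝ :=
  samplingMatrix ω

/-- The probability matrix on the sampling set: the diagonal part of `S P Sᵀ`, where `P` is the
diagonal matrix of the probabilities `p`. -/
def sampledProb {M N : Type*} [DecidableEq M] [Fintype N] [DecidableEq N]
    (S : Matrix M N ℝ) (p : N → ℝ) : Matrix M M ℝ :=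
  Matrix.diagonal (S * Matrix.diagonal p * Sᵀ).diag

/-- The weighting matrix `W₁ = (1/m) I`. -/
def weighting₁ (T m : ℕ) : Matrix (Fin T × Fin m) (Fin T × Fin m) ℝ :=
  Matrix.diagonal fun _ => 1 / (m : ℝ)

/-- The weighting matrix `W₂ = diag((1/m₀) I; …; (1/m_{T-1}) I)`. -/
def weighting₂ {T : ℕ} (m : Fin T → ℕ) : Matrix (Σ t, Fin (m t)) (Σ t, Fin (m t)) ℝ :=
  Matrix.diagonal fun r => 1 / (m r.1 : ℝ)

/-- The weighting matrix `W₃ = (1/m) I`. -/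
def weighting₃ (m : ℕ) : Matrix (Fin m) (Fin m) ℝ :=
  Matrix.diagonal fun _ => 1 / (m : ℝ)

/-- The vector `P^{-1/2} W^{1/2} v` for diagonal matrices `P`, `W` with positive diagonals. -/
def reweight {M : Type*} [Fintype M] [DecidableEq M] (P W : Matrix M M ℝ) (v : M → ℝ) : M → ℝ :=
  (Matrix.diagonal (fun r => (√(P r r))⁻¹) * Matrix.diagonal (fun r => √(W r r))) *ᵥ v

/-- `x'` solves the weighted least-squares problem: it minimizes
`‖P^{-1/2} W^{1/2} (S π_{A,T}(z) - y)‖₂` over `z ∈ E`. -/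
def IsLeastSquares {n T : ℕ} {M : Type*} [Fintype M] [DecidableEq M]
    (E : Submodule ℝ (Fin n → ℝ)) (A : Matrix (Fin n) (Fin n) ℝ)
    (S : Matrix M (Fin T × Fin n) ℝ) (P W : Matrix M M ℝ) (y : M → ℝ) (x' : Fin n → ℝ) : Prop :=
  x' ∈ E ∧ ∀ z ∈ E, l2norm (reweight P W (S *ᵥ diffusionField A T x' - y)) ≤
    l2norm (reweight P W (S *ᵥ diffusionField A T z - y))

/-- For every signal `x ∈ E`: for all noise `e`, the least-squares problem with data
`y = S π_{A,T}(x) + e` has exactly one solution, and its error is at most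
`Cup ‖P^{-1/2} W^{1/2} e‖₂`; and for some nonzero noise `e₀` the error of the solution is at
least `Clow ‖P^{-1/2} W^{1/2} e₀‖₂`. -/
def ErrorBounds {n T : ℕ} {M : Type*} [Fintype M] [DecidableEq M]
    (E : Submodule ℝ (Fin n → ℝ)) (A : Matrix (Fin n) (Fin n) ℝ)
    (S : Matrix M (Fin T × Fin n) ℝ) (P W : Matrix M M ℝ) (Cup Clow : ℝ) : Prop :=
  ∀ x ∈ E,
    (∀ e : M → ℝ,
      (∃! x' : Fin n → ℝ, IsLeastSquares E A S P W (S *ᵥ diffusionField A T x + e) x') ∧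
      ∀ x' : Fin n → ℝ, IsLeastSquares E A S P W (S *ᵥ diffusionField A T x + e) x' →
        l2norm (x' - x) ≤ Cup * l2norm (reweight P W e)) ∧
    (∃ e₀ : M → ℝ, e₀ ≠ 0 ∧
      ∀ x' : Fin n → ℝ, IsLeastSquares E A S P W (S *ᵥ diffusionField A T x + e₀) x' →
        Clow * l2norm (reweight P W e₀) ≤ l2norm (x' - x))

end

end DynSampling

/-! Everything reduces to one spectral estimate. For x = U_k a put b_ℓ = f_T(λ_ℓ) a_ℓ. Since A^t
multiplies u_ℓ by λ_ℓ^t, the space-time field of x is Ũ b, and the squared weighted norm of its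
samples is a quadratic form bᵀ G b, where G is a random sum of reweighted Gram matrices of sampled
rows of Ũ. The columns of Ũ are orthonormal (`sum_rowGram`), and the reweighting makes the
expectation of G the identity.

If (1-δ) I ≤ G ≤ (1+δ) I, the measurement map is bounded above and below on span(U_k), because
f_T(λ_ℓ) lies between f_T(λ_k) and f_T(λ_1) (`errorBounds_of_frame`). Both error bounds are then
deterministic (`errorBounds_of_stable`): the factor 2 is a triangle inequality, and the noise for
the lower bound is the exact sample vector of a nonzero bandlimited signal.

The estimate on G is a matrix Chernoff inequality (`matrix_chernoff`). The summands are independent,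
positive semidefinite and, by the assumption on the number of samples, bounded by R = δ²/(3
log(2k/ε)); the failure probability 2k exp(-δ²/(3R)) is then exactly ε. In the exponential moment of
G one draw has to be averaged at a time although the matrices do not commute. Lieb's concavity
theorem does this (`sum_trace_exp_add_le`). It follows from the joint convexity of the quantum
relative entropy (`relEntropy_convex`) and the Gibbs variational inequality; joint convexity holds
because the relative entropy is an integral of suprema of functionals that are linear in the pair of
matrices. -/

namespace DynSampling

/-! ### Spectral calculus for symmetric matrices. -/

section TraceInequality

set_option linter.unusedSectionVars false

variable {ι : Type*} [Fintype ι] [DecidableEq ι]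

/-- The symmetric matrix with eigenvector matrix `V` and eigenvalues `a`. -/
def specMat (V : Matrix ι ι ℝ) (a : ι → ℝ) : Matrix ι ι ℝ := V * Matrix.diagonal a * Vᵀ

lemma orthogonal_mul_transpose {V : Matrix ι ι ℝ} (hV : V ∈ Matrix.orthogonalGroup ι ℝ) :
    V * Vᵀ = 1 := (Matrix.mem_orthogonalGroup_iff ι ℝ).1 hV

lemma orthogonal_transpose_mul {V : Matrix ι ι ℝ} (hV : V ∈ Matrix.orthogonalGroup ι ℝ) :
    Vᵀ * V = 1 := (Matrix.mem_orthogonalGroup_iff' ι ℝ).1 hV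

lemma exists_specMat_eq {X : Matrix ι ι ℝ} (hX : X.IsSymm) :
    ∃ V ∈ Matrix.orthogonalGroup ι ℝ, ∃ a, X = specMat V a := by
  have hH : X.IsHermitian := hX
  refine ⟨hH.eigenvectorUnitary, hH.eigenvectorUnitary.2, hH.eigenvalues, ?_⟩
  have h := hH.spectral_theorem
  rw [Unitary.conjStarAlgAut_apply] at h
  exact h

lemma specMat_isSymm (V : Matrix ι ι ℝ) (a : ι → ℝ) : (specMat V a).IsSymm := by
  simp [specMat, Matrix.IsSymm, Matrix.transpose_mul, Matrix.mul_assoc]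

lemma specMat_one {V : Matrix ι ι ℝ} (hV : V ∈ Matrix.orthogonalGroup ι ℝ) :
    specMat V (fun _ => 1) = 1 := by
  simp [specMat, orthogonal_mul_transpose hV]

lemma specMat_add (V : Matrix ι ι ℝ) (a b : ι → ℝ) :
    specMat V (fun i => a i + b i) = specMat V a + specMat V b := by
  simp only [specMat, ← Matrix.diagonal_add, Matrix.mul_add, Matrix.add_mul]

lemma specMat_smul (V : Matrix ι ι ℝ) (c : ℝ) (a : ι → ℝ) :
    specMat V (fun i => c * a i) = c • specMat V a := by
  have : (Matrix.diagonal fun i => c * a i) = c • Matrix.diagonal a := by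
    rw [← Matrix.diagonal_smul]; rfl
  simp only [specMat, this, Matrix.mul_smul, Matrix.smul_mul]

lemma exp_specMat {V : Matrix ι ι ℝ} (hV : V ∈ Matrix.orthogonalGroup ι ℝ) (a : ι → ℝ) :
    NormedSpace.exp (specMat V a) = specMat V (fun i => Real.exp (a i)) := by
  have hinv : V⁻¹ = Vᵀ := Matrix.inv_eq_right_inv (orthogonal_mul_transpose hV)
  have hu : IsUnit V := IsUnit.of_mul_eq_one _ (orthogonal_mul_transpose hV)
  have h := Matrix.exp_conj V (Matrix.diagonal a) hu
  rw [hinv, Matrix.exp_diagonal] at h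
  rw [specMat, h, specMat]
  congr 3
  ext i
  rw [Pi.coe_exp, Real.exp_eq_exp_ℝ]

lemma exp_isSymm {X : Matrix ι ι ℝ} (hX : X.IsSymm) : (NormedSpace.exp X).IsSymm := hX.exp

lemma dotProduct_specMat (V : Matrix ι ι ℝ) (a : ι → ℝ) (z : ι → ℝ) :
    z ⬝ᵥ (specMat V a *ᵥ z) = ∑ i, a i * (Vᵀ *ᵥ z) i ^ 2 := by
  rw [specMat, ← Matrix.mulVec_mulVec, ← Matrix.mulVec_mulVec, Matrix.dotProduct_mulVec,
    ← Matrix.mulVec_transpose]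
  simp only [dotProduct, Matrix.mulVec_diagonal]
  exact Finset.sum_congr rfl fun i _ => by ring

lemma dotProduct_self_eq_sum {V : Matrix ι ι ℝ} (hV : V ∈ Matrix.orthogonalGroup ι ℝ)
    (z : ι → ℝ) : z ⬝ᵥ z = ∑ i, (Vᵀ *ᵥ z) i ^ 2 := by
  have h := dotProduct_specMat V (fun _ => 1) z
  rw [specMat_one hV, Matrix.one_mulVec] at h
  simpa using h

lemma transpose_mulVec_col {V : Matrix ι ι ℝ} (hV : V ∈ Matrix.orthogonalGroup ι ℝ) (i : ι) :
    Vᵀ *ᵥ V.col i = Pi.single i 1 := by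
  have : V.col i = V *ᵥ Pi.single i 1 := by simp
  rw [this, Matrix.mulVec_mulVec, orthogonal_transpose_mul hV, Matrix.one_mulVec]

lemma dotProduct_specMat_col {V : Matrix ι ι ℝ} (hV : V ∈ Matrix.orthogonalGroup ι ℝ)
    (a : ι → ℝ) (i : ι) : V.col i ⬝ᵥ (specMat V a *ᵥ V.col i) = a i := by
  rw [dotProduct_specMat, transpose_mulVec_col hV]
  simp [Pi.single_apply]

lemma dotProduct_col_self {V : Matrix ι ι ℝ} (hV : V ∈ Matrix.orthogonalGroup ι ℝ) (i : ι) :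
    V.col i ⬝ᵥ V.col i = 1 := by
  rw [dotProduct_self_eq_sum hV, transpose_mulVec_col hV]
  simp [Pi.single_apply]

/-- The trace of a product of two matrices given in spectral form. -/
lemma trace_specMat_mul_specMat (V W : Matrix ι ι ℝ) (a b : ι → ℝ) :
    (specMat V a * specMat W b).trace = ∑ i, ∑ j, (Vᵀ * W) i j ^ 2 * (a i * b j) := by
  have : (specMat V a * specMat W b).trace =
      ((Matrix.diagonal a * (Vᵀ * W)) * (Matrix.diagonal b * (Vᵀ * W)ᵀ)).trace := by
    simp only [specMat, Matrix.transpose_mul, Matrix.transpose_transpose, Matrix.mul_assoc]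
    rw [Matrix.trace_mul_comm]
    simp only [Matrix.mul_assoc]
  rw [this]
  simp only [Matrix.trace, Matrix.diag_apply, Matrix.mul_apply (M := Matrix.diagonal a * _),
    Matrix.diagonal_mul, Matrix.transpose_apply]
  exact Finset.sum_congr rfl fun i _ => Finset.sum_congr rfl fun j _ => by ring

lemma trace_specMat_mul (V : Matrix ι ι ℝ) (a : ι → ℝ) (B : Matrix ι ι ℝ) :
    (specMat V a * B).trace = ∑ i, a i * (V.col i ⬝ᵥ (B *ᵥ V.col i)) := by
  have : (specMat V a * B).trace = (Matrix.diagonal a * (Vᵀ * (B * V))).trace := by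
    simp only [specMat, Matrix.mul_assoc]
    rw [Matrix.trace_mul_comm]
    simp only [Matrix.mul_assoc]
  rw [this]
  simp only [Matrix.trace, Matrix.diag_apply, Matrix.diagonal_mul]
  rfl

/-! ### Quantum relative entropy and its joint convexity. -/

/-- The Umegaki relative entropy of `exp H` with respect to `exp K`. -/
noncomputable def relEntropy (H K : Matrix ι ι ℝ) : ℝ :=
  (NormedSpace.exp H * (H - K)).trace - (NormedSpace.exp H).trace + (NormedSpace.exp K).trace

/-- The scalar relative entropy. -/
noncomputable def scalarEntropy (a b : ℝ) : ℝ := a * Real.log a - a * Real.log b - a + b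

lemma scalarEntropy_nonneg {a b : ℝ} (ha : 0 < a) (hb : 0 < b) : 0 ≤ scalarEntropy a b := by
  have h := Real.log_le_sub_one_of_pos (div_pos hb ha)
  rw [Real.log_div hb.ne' ha.ne'] at h
  have h2 := mul_le_mul_of_nonneg_left h ha.le
  have h3 : a * (b / a - 1) = b - a := by field_simp
  rw [scalarEntropy]
  nlinarith

lemma segment_pos {a b u : ℝ} (ha : 0 < a) (hb : 0 < b) (hu : u ∈ Set.Icc (0 : ℝ) 1) :
    0 < (1 - u) * a + u * b := by
  rcases hu.1.eq_or_lt with h | h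
  · simpa [← h] using ha
  · have := mul_pos h hb
    have := mul_nonneg (sub_nonneg.2 hu.2) ha.le
    linarith

lemma continuousOn_entropyKernel {a b : ℝ} (ha : 0 < a) (hb : 0 < b) :
    ContinuousOn (fun u : ℝ => u * ((a - b) ^ 2 / ((1 - u) * a + u * b))) (Set.Icc 0 1) := by
  refine continuousOn_id.mul (continuousOn_const.div (by fun_prop) fun u hu => ?_)
  exact (segment_pos ha hb hu).ne'

lemma intervalIntegrable_entropyKernel {a b : ℝ} (ha : 0 < a) (hb : 0 < b) :
    IntervalIntegrable (fun u : ℝ => u * ((a - b) ^ 2 / ((1 - u) * a + u * b))) volume 0 1 :=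
  ContinuousOn.intervalIntegrable (by
    rw [Set.uIcc_of_le zero_le_one]; exact continuousOn_entropyKernel ha hb)

/-- The integrand is quadratic over linear in (a, b), hence a supremum of linear functions. The
matrix version inherits this form, which is what makes it convex. -/
lemma scalarEntropy_eq_integral {a b : ℝ} (ha : 0 < a) (hb : 0 < b) :
    scalarEntropy a b = ∫ u in (0 : ℝ)..1, u * ((a - b) ^ 2 / ((1 - u) * a + u * b)) := by
  -- With d = (1-u)a + ub, the derivative is (b-a) - a(b-a)/d = (b-a)(d-a)/d, and d - a = u(b-a).
  rw [intervalIntegral.integral_eq_sub_of_hasDerivAt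
    (f := fun u => u * (b - a) - a * Real.log ((1 - u) * a + u * b)) ?_
    (intervalIntegrable_entropyKernel ha hb)]
  · simp [scalarEntropy]; ring
  · intro u hu
    rw [Set.uIcc_of_le zero_le_one] at hu
    have hp := segment_pos ha hb hu
    have h1 : HasDerivAt (fun u : ℝ => (1 - u) * a + u * b) (-1 * a + 1 * b) u :=
      (((hasDerivAt_id u).const_sub 1).mul_const a).add ((hasDerivAt_id u).mul_const b)
    have h2 := ((hasDerivAt_id u).mul_const (b - a)).sub ((h1.log hp.ne').const_mul a)
    refine h2.congr_deriv ?_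
    rw [mul_div_assoc', mul_div_assoc', sub_eq_iff_eq_add, ← add_div, eq_div_iff hp.ne']
    ring

/-- Every trace is expanded over pairs of eigenvectors with the same weights, the squared overlaps.
Traces that involve only one of the two matrices are brought to this form by inserting the identity
in the eigenbasis of the other. -/
lemma relEntropy_specMat {V W : Matrix ι ι ℝ} (hV : V ∈ Matrix.orthogonalGroup ι ℝ)
    (hW : W ∈ Matrix.orthogonalGroup ι ℝ) (h κ : ι → ℝ) :
    relEntropy (specMat V h) (specMat W κ) =
      ∑ i, ∑ j, (Vᵀ * W) i j ^ 2 * scalarEntropy (Real.exp (h i)) (Real.exp (κ j)) := by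
  have e1 : NormedSpace.exp (specMat V h) * specMat V h =
      specMat V (fun i => Real.exp (h i) * h i) * specMat W (fun _ => 1) := by
    rw [exp_specMat hV, specMat_one hW, mul_one]
    simp only [specMat, Matrix.mul_assoc]
    rw [← Matrix.mul_assoc Vᵀ V, orthogonal_transpose_mul hV, one_mul,
      ← Matrix.mul_assoc (Matrix.diagonal _) (Matrix.diagonal _), Matrix.diagonal_mul_diagonal]
  have e2 : (specMat V fun i => Real.exp (h i)).trace =
      (specMat V (fun i => Real.exp (h i)) * specMat W (fun _ => 1)).trace := by
    rw [specMat_one hW, mul_one]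
  have e3 : (NormedSpace.exp (specMat W κ)) =
      specMat V (fun _ => 1) * specMat W (fun j => Real.exp (κ j)) := by
    rw [exp_specMat hW, specMat_one hV, one_mul]
  rw [relEntropy, Matrix.mul_sub, Matrix.trace_sub, e1, e3, exp_specMat hV, e2,
    trace_specMat_mul_specMat, trace_specMat_mul_specMat, trace_specMat_mul_specMat,
    trace_specMat_mul_specMat]
  rw [← Finset.sum_sub_distrib, ← Finset.sum_sub_distrib, ← Finset.sum_add_distrib]
  refine Finset.sum_congr rfl fun i _ => ?_
  rw [← Finset.sum_sub_distrib, ← Finset.sum_sub_distrib, ← Finset.sum_add_distrib]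
  refine Finset.sum_congr rfl fun j _ => ?_
  simp only [scalarEntropy, Real.log_exp]
  ring

/-- Klein's inequality. -/
lemma relEntropy_nonneg {H K : Matrix ι ι ℝ} (hH : H.IsSymm) (hK : K.IsSymm) :
    0 ≤ relEntropy H K := by
  obtain ⟨V, hV, h, rfl⟩ := exists_specMat_eq hH
  obtain ⟨W, hW, κ, rfl⟩ := exists_specMat_eq hK
  rw [relEntropy_specMat hV hW]
  exact Finset.sum_nonneg fun i _ => Finset.sum_nonneg fun j _ =>
    mul_nonneg (sq_nonneg _) (scalarEntropy_nonneg (Real.exp_pos _) (Real.exp_pos _))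

/-- A family of functionals, linear in `(M, A)`, whose suprema over `Z` integrate to the
relative entropy. -/
def entropyFunctional (u : ℝ) (Z M A : Matrix ι ι ℝ) : ℝ :=
  2 * ((M - A) * Zᵀ).trace - (1 - u) * (M * (Z * Zᵀ)).trace - u * (A * (Zᵀ * Z)).trace

lemma entropyFunctional_sum {α : Type*} (s : Finset α) (w : α → ℝ) (u : ℝ) (Z : Matrix ι ι ℝ)
    (M A : α → Matrix ι ι ℝ) :
    entropyFunctional u Z (∑ x ∈ s, w x • M x) (∑ x ∈ s, w x • A x) =
      ∑ x ∈ s, w x * entropyFunctional u Z (M x) (A x) := by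
  simp only [entropyFunctional, Matrix.sub_mul, Matrix.trace_sub, Finset.sum_mul,
    Matrix.trace_sum, Matrix.smul_mul, Matrix.trace_smul, smul_eq_mul, mul_sub,
    Finset.sum_sub_distrib, Finset.mul_sum]
  simp only [mul_left_comm, mul_comm, mul_assoc]

/-- Writing Z = V Y Wᵀ decouples the functional into one concave quadratic polynomial per entry of
Y, so the maximization over Z can be done entry by entry. -/
lemma entropyFunctional_specMat {V W : Matrix ι ι ℝ} (hV : V ∈ Matrix.orthogonalGroup ι ℝ)
    (hW : W ∈ Matrix.orthogonalGroup ι ℝ) (a b : ι → ℝ) (u : ℝ) (Y : Matrix ι ι ℝ) :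
    entropyFunctional u (V * Y * Wᵀ) (specMat V a) (specMat W b) =
      ∑ i, ∑ j, (2 * (Y i j * (Vᵀ * W) i j * (a i - b j)) -
        Y i j ^ 2 * ((1 - u) * a i + u * b j)) := by
  have hVV := orthogonal_transpose_mul hV
  have hWW := orthogonal_transpose_mul hW
  have hVV' : ∀ B : Matrix ι ι ℝ, Vᵀ * (V * B) = B := fun B => by
    rw [← Matrix.mul_assoc, hVV, one_mul]
  have hWW' : ∀ B : Matrix ι ι ℝ, Wᵀ * (W * B) = B := fun B => by
    rw [← Matrix.mul_assoc, hWW, one_mul]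
  have t1 : (specMat V a * (V * Y * Wᵀ)ᵀ).trace = ∑ i, ∑ j, Y i j * (Vᵀ * W) i j * a i := by
    have : (specMat V a * (V * Y * Wᵀ)ᵀ).trace =
        (Matrix.diagonal a * ((Vᵀ * W) * Yᵀ)).trace := by
      simp only [specMat, Matrix.transpose_mul, Matrix.transpose_transpose, Matrix.mul_assoc]
      rw [Matrix.trace_mul_comm]
      simp only [Matrix.mul_assoc, hVV, mul_one]
    rw [this]
    simp only [Matrix.trace, Matrix.diag_apply, Matrix.diagonal_mul,
      Matrix.mul_apply (M := Vᵀ * W), Matrix.transpose_apply, Finset.mul_sum]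
    exact Finset.sum_congr rfl fun i _ => Finset.sum_congr rfl fun j _ => by ring
  have t2 : (specMat W b * (V * Y * Wᵀ)ᵀ).trace = ∑ i, ∑ j, Y i j * (Vᵀ * W) i j * b j := by
    have : (specMat W b * (V * Y * Wᵀ)ᵀ).trace =
        (Matrix.diagonal b * (Yᵀ * (Vᵀ * W))).trace := by
      simp only [specMat, Matrix.transpose_mul, Matrix.transpose_transpose, Matrix.mul_assoc]
      rw [Matrix.trace_mul_comm]
      simp only [Matrix.mul_assoc, hWW']
    rw [this, Finset.sum_comm]
    simp only [Matrix.trace, Matrix.diag_apply, Matrix.diagonal_mul,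
      Matrix.mul_apply (M := Yᵀ), Matrix.transpose_apply, Finset.mul_sum]
    exact Finset.sum_congr rfl fun i _ => Finset.sum_congr rfl fun j _ => by ring
  have t3 : (specMat V a * ((V * Y * Wᵀ) * (V * Y * Wᵀ)ᵀ)).trace =
      ∑ i, ∑ j, Y i j ^ 2 * a i := by
    have : (specMat V a * ((V * Y * Wᵀ) * (V * Y * Wᵀ)ᵀ)).trace =
        (Matrix.diagonal a * (Y * Yᵀ)).trace := by
      simp only [specMat, Matrix.transpose_mul, Matrix.transpose_transpose, Matrix.mul_assoc]
      rw [Matrix.trace_mul_comm]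
      simp only [Matrix.mul_assoc, hVV', hWW', hVV, mul_one]
    rw [this]
    simp only [Matrix.trace, Matrix.diag_apply, Matrix.diagonal_mul,
      Matrix.mul_apply (M := Y), Matrix.transpose_apply, Finset.mul_sum]
    exact Finset.sum_congr rfl fun i _ => Finset.sum_congr rfl fun j _ => by ring
  have t4 : (specMat W b * ((V * Y * Wᵀ)ᵀ * (V * Y * Wᵀ))).trace =
      ∑ i, ∑ j, Y i j ^ 2 * b j := by
    have : (specMat W b * ((V * Y * Wᵀ)ᵀ * (V * Y * Wᵀ))).trace =
        (Matrix.diagonal b * (Yᵀ * Y)).trace := by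
      simp only [specMat, Matrix.transpose_mul, Matrix.transpose_transpose, Matrix.mul_assoc]
      rw [Matrix.trace_mul_comm]
      simp only [Matrix.mul_assoc, hVV', hWW', hWW, mul_one]
    rw [this, Finset.sum_comm]
    simp only [Matrix.trace, Matrix.diag_apply, Matrix.diagonal_mul,
      Matrix.mul_apply (M := Yᵀ), Matrix.transpose_apply, Finset.mul_sum]
    exact Finset.sum_congr rfl fun i _ => Finset.sum_congr rfl fun j _ => by ring
  rw [entropyFunctional, Matrix.sub_mul, Matrix.trace_sub, t1, t2, t3, t4]
  simp only [Finset.mul_sum, ← Finset.sum_sub_distrib]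
  exact Finset.sum_congr rfl fun i _ => Finset.sum_congr rfl fun j _ => by ring

/-- The supremum of `entropyFunctional u · M A` for matrices `M`, `A` in spectral form. -/
noncomputable def entropySup (u : ℝ) (V W : Matrix ι ι ℝ) (a b : ι → ℝ) : ℝ :=
  ∑ i, ∑ j, (Vᵀ * W) i j ^ 2 * ((a i - b j) ^ 2 / ((1 - u) * a i + u * b j))

lemma entropyFunctional_le_entropySup {V W : Matrix ι ι ℝ}
    (hV : V ∈ Matrix.orthogonalGroup ι ℝ) (hW : W ∈ Matrix.orthogonalGroup ι ℝ) {a b : ι → ℝ}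
    (ha : ∀ i, 0 < a i) (hb : ∀ i, 0 < b i) {u : ℝ} (hu : u ∈ Set.Icc (0 : ℝ) 1)
    (Z : Matrix ι ι ℝ) :
    entropyFunctional u Z (specMat V a) (specMat W b) ≤ entropySup u V W a b := by
  have hZ : Z = V * (Vᵀ * Z * W) * Wᵀ := by
    simp only [← Matrix.mul_assoc, orthogonal_mul_transpose hV, one_mul]
    rw [Matrix.mul_assoc, orthogonal_mul_transpose hW, mul_one]
  rw [hZ, entropyFunctional_specMat hV hW]
  refine Finset.sum_le_sum fun i _ => Finset.sum_le_sum fun j _ => ?_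
  have hp := segment_pos (ha i) (hb j) hu
  set d := (1 - u) * a i + u * b j
  set y := (Vᵀ * Z * W) i j
  set c := (Vᵀ * W) i j
  rw [← mul_div_assoc, le_div_iff₀ hp]
  -- Completing the square in y.
  nlinarith [sq_nonneg (y * d - c * (a i - b j))]

lemma exists_entropyFunctional_eq {V W : Matrix ι ι ℝ}
    (hV : V ∈ Matrix.orthogonalGroup ι ℝ) (hW : W ∈ Matrix.orthogonalGroup ι ℝ) {a b : ι → ℝ}
    (ha : ∀ i, 0 < a i) (hb : ∀ i, 0 < b i) {u : ℝ} (hu : u ∈ Set.Icc (0 : ℝ) 1) :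
    ∃ Z, entropyFunctional u Z (specMat V a) (specMat W b) = entropySup u V W a b := by
  -- The vertex of each entrywise parabola.
  refine ⟨V * (Matrix.of fun i j =>
    (Vᵀ * W) i j * (a i - b j) / ((1 - u) * a i + u * b j)) * Wᵀ, ?_⟩
  rw [entropyFunctional_specMat hV hW]
  refine Finset.sum_congr rfl fun i _ => Finset.sum_congr rfl fun j _ => ?_
  have hp := segment_pos (ha i) (hb j) hu
  simp only [Matrix.of_apply]
  set d := (1 - u) * a i + u * b j
  field_simp
  ring

lemma intervalIntegrable_mul_entropySup (V W : Matrix ι ι ℝ) {a b : ι → ℝ}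
    (ha : ∀ i, 0 < a i) (hb : ∀ i, 0 < b i) :
    IntervalIntegrable (fun u => u * entropySup u V W a b) volume 0 1 := by
  refine ContinuousOn.intervalIntegrable ?_
  rw [Set.uIcc_of_le zero_le_one]
  refine continuousOn_id.mul ?_
  refine continuousOn_finsetSum _ fun i _ => continuousOn_finsetSum _ fun j _ => ?_
  refine continuousOn_const.mul (continuousOn_const.div (by fun_prop) fun u hu => ?_)
  exact (segment_pos (ha i) (hb j) hu).ne'

lemma relEntropy_eq_integral {V W : Matrix ι ι ℝ} (hV : V ∈ Matrix.orthogonalGroup ι ℝ)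
    (hW : W ∈ Matrix.orthogonalGroup ι ℝ) (h κ : ι → ℝ) :
    relEntropy (specMat V h) (specMat W κ) =
      ∫ u in (0 : ℝ)..1, u * entropySup u V W (fun i => Real.exp (h i))
        (fun j => Real.exp (κ j)) := by
  have hint : ∀ i j, IntervalIntegrable (fun u : ℝ => (Vᵀ * W) i j ^ 2 *
      (u * ((Real.exp (h i) - Real.exp (κ j)) ^ 2 /
        ((1 - u) * Real.exp (h i) + u * Real.exp (κ j))))) volume 0 1 := fun i j =>
    (intervalIntegrable_entropyKernel (Real.exp_pos _) (Real.exp_pos _)).const_mul _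
  have e : ∀ u : ℝ, u * entropySup u V W (fun i => Real.exp (h i)) (fun j => Real.exp (κ j)) =
      ∑ i, ∑ j, (Vᵀ * W) i j ^ 2 * (u * ((Real.exp (h i) - Real.exp (κ j)) ^ 2 /
        ((1 - u) * Real.exp (h i) + u * Real.exp (κ j)))) := fun u => by
    simp only [entropySup, Finset.mul_sum]
    exact Finset.sum_congr rfl fun i _ => Finset.sum_congr rfl fun j _ => by ring
  simp only [e]
  rw [relEntropy_specMat hV hW, intervalIntegral.integral_finsetSum
    fun i _ => by
      have := IntervalIntegrable.sum Finset.univ (fun j _ => hint i j)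
      simpa only [Finset.sum_fn] using this]
  refine Finset.sum_congr rfl fun i _ => ?_
  rw [intervalIntegral.integral_finsetSum fun j _ => hint i j]
  refine Finset.sum_congr rfl fun j _ => ?_
  rw [intervalIntegral.integral_const_mul,
    scalarEntropy_eq_integral (Real.exp_pos _) (Real.exp_pos _)]

/-- Joint convexity of the quantum relative entropy. -/
lemma relEntropy_convex {α : Type*} (s : Finset α) {w : α → ℝ} (hw : ∀ x, 0 ≤ w x)
    {H K : α → Matrix ι ι ℝ} (hH : ∀ x, (H x).IsSymm) (hK : ∀ x, (K x).IsSymm)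
    {H₀ K₀ : Matrix ι ι ℝ} (hH₀ : H₀.IsSymm) (hK₀ : K₀.IsSymm)
    (hHe : NormedSpace.exp H₀ = ∑ x ∈ s, w x • NormedSpace.exp (H x))
    (hKe : NormedSpace.exp K₀ = ∑ x ∈ s, w x • NormedSpace.exp (K x)) :
    relEntropy H₀ K₀ ≤ ∑ x ∈ s, w x * relEntropy (H x) (K x) := by
  obtain ⟨V₀, hV₀, h₀, rfl⟩ := exists_specMat_eq hH₀
  obtain ⟨W₀, hW₀, κ₀, rfl⟩ := exists_specMat_eq hK₀
  choose V hV h hHx using fun x => exists_specMat_eq (hH x)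
  choose W hW κ hKx using fun x => exists_specMat_eq (hK x)
  simp only [hHx, hKx] at hHe hKe ⊢
  simp only [fun x => relEntropy_eq_integral (hV x) (hW x) (h x) (κ x)]
  rw [relEntropy_eq_integral hV₀ hW₀]
  have hi : ∀ x, IntervalIntegrable (fun u => u * entropySup u (V x) (W x)
      (fun i => Real.exp (h x i)) (fun j => Real.exp (κ x j))) volume 0 1 := fun x =>
    intervalIntegrable_mul_entropySup _ _ (fun _ => Real.exp_pos _) (fun _ => Real.exp_pos _)
  simp only [← intervalIntegral.integral_const_mul]
  rw [← intervalIntegral.integral_finsetSum fun x _ => (hi x).const_mul _]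
  refine intervalIntegral.integral_mono_on zero_le_one
    (intervalIntegrable_mul_entropySup _ _ (fun _ => Real.exp_pos _) (fun _ => Real.exp_pos _))
    (by
      have := IntervalIntegrable.sum s (fun x _ => (hi x).const_mul (w x))
      simpa only [Finset.sum_fn] using this) fun u hu => ?_
  -- For each u, the Z that is optimal for the averaged pair is a competitor for every pair in the
  -- family, and the functional is linear in the pair; this gives convexity of the integrand
  -- pointwise in u.
  obtain ⟨Z, hZ⟩ := exists_entropyFunctional_eq hV₀ hW₀ (a := fun i => Real.exp (h₀ i))
    (b := fun i => Real.exp (κ₀ i)) (fun _ => Real.exp_pos _) (fun _ => Real.exp_pos _) hu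
  rw [← hZ, ← exp_specMat hV₀, ← exp_specMat hW₀, hHe, hKe, entropyFunctional_sum,
    Finset.mul_sum]
  refine Finset.sum_le_sum fun x _ => ?_
  rw [mul_left_comm]
  refine mul_le_mul_of_nonneg_left (mul_le_mul_of_nonneg_left ?_ hu.1) (hw x)
  rw [exp_specMat (hV x), exp_specMat (hW x)]
  exact entropyFunctional_le_entropySup (hV x) (hW x) (fun _ => Real.exp_pos _)
    (fun _ => Real.exp_pos _) hu Z

/-! ### Gibbs variational principle and Lieb's theorem. -/

/-- The Gibbs variational inequality. -/
lemma trace_exp_ge {H K : Matrix ι ι ℝ} (hH : H.IsSymm) (hK : K.IsSymm) :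
    (NormedSpace.exp H).trace + (NormedSpace.exp H * (K - H)).trace ≤
      (NormedSpace.exp K).trace := by
  have h := relEntropy_nonneg hH hK
  rw [relEntropy, ← neg_sub K H, Matrix.mul_neg, Matrix.trace_neg] at h
  linarith

lemma trace_exp_mul_nonneg {H B : Matrix ι ι ℝ} (hH : H.IsSymm)
    (hB : ∀ z, 0 ≤ z ⬝ᵥ (B *ᵥ z)) : 0 ≤ (NormedSpace.exp H * B).trace := by
  obtain ⟨V, hV, h, rfl⟩ := exists_specMat_eq hH
  rw [exp_specMat hV, trace_specMat_mul]
  exact Finset.sum_nonneg fun i _ => mul_nonneg (Real.exp_pos _).le (hB _)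

/-- The exponential is not operator monotone, but its trace is: the Gibbs inequality bounds the
trace at K below by its tangent at H, and the slope pairs a positive matrix with a positive
semidefinite one. -/
lemma trace_exp_mono {H K : Matrix ι ι ℝ} (hH : H.IsSymm) (hK : K.IsSymm)
    (hHK : ∀ z, z ⬝ᵥ (H *ᵥ z) ≤ z ⬝ᵥ (K *ᵥ z)) :
    (NormedSpace.exp H).trace ≤ (NormedSpace.exp K).trace := by
  have h := trace_exp_ge hH hK
  have h2 : 0 ≤ (NormedSpace.exp H * (K - H)).trace := trace_exp_mul_nonneg hH fun z => by
    rw [Matrix.sub_mulVec, dotProduct_sub]; linarith [hHK z]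
  linarith

lemma exists_exp_eq {A : Matrix ι ι ℝ} (hA : A.IsSymm)
    (hpos : ∀ z, z ≠ 0 → 0 < z ⬝ᵥ (A *ᵥ z)) :
    ∃ K : Matrix ι ι ℝ, K.IsSymm ∧ NormedSpace.exp K = A := by
  obtain ⟨V, hV, a, rfl⟩ := exists_specMat_eq hA
  have ha : ∀ i, 0 < a i := fun i => by
    rw [← dotProduct_specMat_col hV a i]
    refine hpos _ fun h0 => ?_
    have := dotProduct_col_self hV i
    simp [h0] at this
  refine ⟨specMat V fun i => Real.log (a i), specMat_isSymm _ _, ?_⟩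
  rw [exp_specMat hV]
  congr 1
  funext i
  exact Real.exp_log (ha i)

lemma dotProduct_exp_pos {H : Matrix ι ι ℝ} (hH : H.IsSymm) {z : ι → ℝ} (hz : z ≠ 0) :
    0 < z ⬝ᵥ (NormedSpace.exp H *ᵥ z) := by
  obtain ⟨V, hV, h, rfl⟩ := exists_specMat_eq hH
  rw [exp_specMat hV, dotProduct_specMat]
  have hne : Vᵀ *ᵥ z ≠ 0 := fun h0 => hz <| by
    have := congrArg (V *ᵥ ·) h0
    simpa [Matrix.mulVec_mulVec, orthogonal_mul_transpose hV] using this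
  obtain ⟨i, hi⟩ := Function.ne_iff.1 hne
  refine Finset.sum_pos' (fun i _ => mul_nonneg (Real.exp_pos _).le (sq_nonneg _))
    ⟨i, Finset.mem_univ _, mul_pos (Real.exp_pos _) (sq_pos_iff.2 hi)⟩

lemma isSymm_sum_smul {α : Type*} (s : Finset α) (w : α → ℝ) {X : α → Matrix ι ι ℝ}
    (hX : ∀ x, (X x).IsSymm) : (∑ x ∈ s, w x • X x).IsSymm := by
  rw [Matrix.IsSymm, Matrix.transpose_sum]
  exact Finset.sum_congr rfl fun x _ => by rw [Matrix.transpose_smul, (hX x).eq]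

lemma dotProduct_sum_smul {α : Type*} (s : Finset α) (w : α → ℝ) (X : α → Matrix ι ι ℝ)
    (z : ι → ℝ) :
    z ⬝ᵥ ((∑ x ∈ s, w x • X x) *ᵥ z) = ∑ x ∈ s, w x * (z ⬝ᵥ (X x *ᵥ z)) := by
  simp only [Matrix.sum_mulVec, dotProduct_sum, Matrix.smul_mulVec, dotProduct_smul, smul_eq_mul]

/-- Lieb's concavity theorem, in the form of a Jensen inequality for
`exp K ↦ tr exp (Y + K)`. -/
lemma sum_trace_exp_add_le {α : Type*} (s : Finset α) {w : α → ℝ} (hw : ∀ x, 0 ≤ w x)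
    (hw1 : ∑ x ∈ s, w x = 1) {Y : Matrix ι ι ℝ} (hY : Y.IsSymm)
    {K : α → Matrix ι ι ℝ} (hK : ∀ x, (K x).IsSymm) {K₀ : Matrix ι ι ℝ} (hK₀ : K₀.IsSymm)
    (hKe : NormedSpace.exp K₀ = ∑ x ∈ s, w x • NormedSpace.exp (K x)) :
    ∑ x ∈ s, w x * (NormedSpace.exp (Y + K x)).trace ≤ (NormedSpace.exp (Y + K₀)).trace := by
  have hYK : ∀ x, (Y + K x).IsSymm := fun x => hY.add (hK x)
  obtain ⟨x₀, hx₀, hwx₀⟩ : ∃ x ∈ s, 0 < w x := by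
    by_contra! hcon
    have := Finset.sum_nonpos hcon
    linarith
  -- `H₀` is the logarithm of the averaged exponential, which is positive definite because some
  -- weight is positive. It is the trial matrix in the Gibbs inequality for Y + K₀; joint convexity
  -- then compares it with the single terms, where the Gibbs inequality is an equality.
  obtain ⟨H₀, hH₀, hHe⟩ := exists_exp_eq
    (isSymm_sum_smul s w fun x => exp_isSymm (hYK x)) fun z hz => by
      rw [dotProduct_sum_smul]
      exact Finset.sum_pos'
        (fun x _ => mul_nonneg (hw x) (dotProduct_exp_pos (hYK x) hz).le)
        ⟨x₀, hx₀, mul_pos hwx₀ (dotProduct_exp_pos (hYK x₀) hz)⟩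
  have hconv := relEntropy_convex s hw hYK hK hH₀ hK₀ hHe hKe
  have hgibbs := trace_exp_ge hH₀ (hY.add hK₀)
  have hrel : ∑ x ∈ s, w x * relEntropy (Y + K x) (K x) =
      (NormedSpace.exp H₀ * Y).trace - (NormedSpace.exp H₀).trace +
        (NormedSpace.exp K₀).trace := by
    rw [hHe, hKe, Finset.sum_mul]
    simp only [Matrix.trace_sum, Matrix.smul_mul, Matrix.trace_smul, smul_eq_mul,
      ← Finset.sum_sub_distrib, ← Finset.sum_add_distrib]
    refine Finset.sum_congr rfl fun x _ => ?_
    rw [relEntropy, add_sub_cancel_right]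
    ring
  have htr : ∑ x ∈ s, w x * (NormedSpace.exp (Y + K x)).trace = (NormedSpace.exp H₀).trace := by
    rw [hHe, Matrix.trace_sum]
    exact Finset.sum_congr rfl fun x _ => by rw [Matrix.trace_smul, smul_eq_mul]
  rw [htr]
  rw [hrel, relEntropy] at hconv
  have e : NormedSpace.exp H₀ * (Y + K₀ - H₀) =
      NormedSpace.exp H₀ * Y - NormedSpace.exp H₀ * (H₀ - K₀) := by
    rw [← Matrix.mul_sub]; congr 1; abel
  rw [e, Matrix.trace_sub] at hgibbs
  linarith

/-! ### The matrix Laplace transform for one draw. -/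

/-- A spectral comparison: `θ x ≤ log (1 + c x)` on `[0, R]`. -/
lemma mul_le_log_one_add {R θ x : ℝ} (hR : 0 < R) (hx : 0 ≤ x) (hxR : x ≤ R) :
    0 < 1 + (Real.exp (θ * R) - 1) / R * x ∧
      θ * x ≤ Real.log (1 + (Real.exp (θ * R) - 1) / R * x) := by
  -- On [0, θR] the exponential lies below its chord, evaluated here at θx. This holds for either
  -- sign of θ, so both tails are covered, and it also gives positivity of the argument of the
  -- logarithm.
  have h := convexOn_exp.2 (Set.mem_univ 0) (Set.mem_univ (θ * R))
    (sub_nonneg.2 ((div_le_one hR).2 hxR)) (div_nonneg hx hR.le) (by ring)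
  simp only [smul_eq_mul, mul_zero, zero_add, Real.exp_zero, mul_one] at h
  have e1 : x / R * (θ * R) = θ * x := by field_simp
  have e2 : 1 - x / R + x / R * Real.exp (θ * R) =
      1 + (Real.exp (θ * R) - 1) / R * x := by field_simp; ring
  rw [e1, e2] at h
  have hpos := (Real.exp_pos (θ * x)).trans_le h
  exact ⟨hpos, (Real.le_log_iff_exp_le hpos).2 h⟩

/-- `K` plays the role of log(1 + cX), described through its exponential as Lieb's theorem requires.
The lower comparison is the chord bound applied to eigenvalues, the upper one is log(1 + s) ≤ s. -/
lemma exists_exp_eq_one_add {X : Matrix ι ι ℝ} (hX : X.IsSymm) {R θ : ℝ} (hR : 0 < R)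
    (h0 : ∀ z, 0 ≤ z ⬝ᵥ (X *ᵥ z)) (hXR : ∀ z, z ⬝ᵥ (X *ᵥ z) ≤ R * (z ⬝ᵥ z)) :
    ∃ K : Matrix ι ι ℝ, K.IsSymm ∧
      NormedSpace.exp K = 1 + ((Real.exp (θ * R) - 1) / R) • X ∧
      (∀ z, z ⬝ᵥ ((θ • X) *ᵥ z) ≤ z ⬝ᵥ (K *ᵥ z)) ∧
      ∀ z, z ⬝ᵥ (K *ᵥ z) ≤ z ⬝ᵥ ((((Real.exp (θ * R) - 1) / R) • X) *ᵥ z) := by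
  set c := (Real.exp (θ * R) - 1) / R with hc
  obtain ⟨V, hV, a, rfl⟩ := exists_specMat_eq hX
  have ha : ∀ i, 0 < 1 + c * a i ∧ θ * a i ≤ Real.log (1 + c * a i) := fun i => by
    refine mul_le_log_one_add hR ?_ ?_
    · simpa [dotProduct_specMat_col hV] using h0 (V.col i)
    · simpa [dotProduct_specMat_col hV, dotProduct_col_self hV] using hXR (V.col i)
  refine ⟨specMat V fun i => Real.log (1 + c * a i), specMat_isSymm _ _, ?_, fun z => ?_,
    fun z => ?_⟩
  · rw [exp_specMat hV, ← specMat_smul, ← specMat_one hV, ← specMat_add]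
    congr 1
    funext i
    exact Real.exp_log (ha i).1
  · rw [← specMat_smul, dotProduct_specMat, dotProduct_specMat]
    exact Finset.sum_le_sum fun i _ => mul_le_mul_of_nonneg_right (ha i).2 (sq_nonneg _)
  · rw [← specMat_smul, dotProduct_specMat, dotProduct_specMat]
    refine Finset.sum_le_sum fun i _ => mul_le_mul_of_nonneg_right ?_ (sq_nonneg _)
    linarith [Real.log_le_sub_one_of_pos (ha i).1]

/-- One step of the matrix Laplace transform method. -/
lemma sum_trace_exp_add_smul_le {α : Type*} (s : Finset α) {w : α → ℝ} (hw : ∀ x, 0 ≤ w x)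
    (hw1 : ∑ x ∈ s, w x = 1) {Y : Matrix ι ι ℝ} (hY : Y.IsSymm)
    {X : α → Matrix ι ι ℝ} (hX : ∀ x, (X x).IsSymm) {R : ℝ} (hR : 0 < R) (θ : ℝ)
    (h0 : ∀ x z, 0 ≤ z ⬝ᵥ (X x *ᵥ z)) (hXR : ∀ x z, z ⬝ᵥ (X x *ᵥ z) ≤ R * (z ⬝ᵥ z)) :
    ∑ x ∈ s, w x * (NormedSpace.exp (Y + θ • X x)).trace ≤
      (NormedSpace.exp (Y + ((Real.exp (θ * R) - 1) / R) • ∑ x ∈ s, w x • X x)).trace := by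
  -- Each θX is replaced by the larger log(1 + cX), whose exponential is affine in X. Lieb's theorem
  -- then moves the average inside, and the resulting logarithm is bounded by c times the mean.
  choose K hKs hKe hKl _ using fun x => exists_exp_eq_one_add (hX x) (θ := θ) hR (h0 x) (hXR x)
  obtain ⟨K₀, hK₀s, hK₀e, _, hK₀u⟩ := exists_exp_eq_one_add (isSymm_sum_smul s w hX) (θ := θ) hR
    (fun z => by
      rw [dotProduct_sum_smul]
      exact Finset.sum_nonneg fun x _ => mul_nonneg (hw x) (h0 x z))
    (fun z => by
      rw [dotProduct_sum_smul]
      calc ∑ x ∈ s, w x * (z ⬝ᵥ (X x *ᵥ z)) ≤ ∑ x ∈ s, w x * (R * (z ⬝ᵥ z)) :=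
            Finset.sum_le_sum fun x _ => mul_le_mul_of_nonneg_left (hXR x z) (hw x)
        _ = R * (z ⬝ᵥ z) := by rw [← Finset.sum_mul, hw1, one_mul])
  have hstep := sum_trace_exp_add_le s hw hw1 hY hKs hK₀s (by
    rw [hK₀e]
    simp only [hKe, smul_add, Finset.sum_add_distrib, ← Finset.sum_smul, hw1, one_smul,
      Finset.smul_sum]
    congr 1
    exact Finset.sum_congr rfl fun x _ => smul_comm _ _ _)
  have hS : (∑ x ∈ s, w x • X x).IsSymm := isSymm_sum_smul s w hX
  refine le_trans (Finset.sum_le_sum fun x _ => mul_le_mul_of_nonneg_left ?_ (hw x))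
    (hstep.trans ?_)
  · refine trace_exp_mono (hY.add ((hX x).smul θ)) (hY.add (hKs x)) fun z => ?_
    rw [Matrix.add_mulVec, Matrix.add_mulVec, dotProduct_add, dotProduct_add]
    linarith [hKl x z]
  · refine trace_exp_mono (hY.add hK₀s) (hY.add (hS.smul _)) fun z => ?_
    rw [Matrix.add_mulVec, Matrix.add_mulVec, dotProduct_add, dotProduct_add]
    linarith [hK₀u z]

end TraceInequality

/-! ### The matrix Chernoff inequality. -/

section Chernoff

variable {η : Type*} [Fintype η] [DecidableEq η]

lemma trace_specMat {V : Matrix η η ℝ} (hV : V ∈ Matrix.orthogonalGroup η ℝ) (a : η → ℝ) :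
    (specMat V a).trace = ∑ i, a i := by
  have h := trace_specMat_mul V a 1
  simpa [dotProduct_col_self hV] using h

lemma trace_exp_smul_one (c : ℝ) :
    (NormedSpace.exp (c • (1 : Matrix η η ℝ))).trace = Fintype.card η * Real.exp c := by
  have h1 : (1 : Matrix η η ℝ) ∈ Matrix.orthogonalGroup η ℝ := one_mem _
  rw [← specMat_one h1, ← specMat_smul, exp_specMat h1, trace_specMat h1]
  simp

lemma trace_exp_nonneg {H : Matrix η η ℝ} (hH : H.IsSymm) : 0 ≤ (NormedSpace.exp H).trace := by
  obtain ⟨V, hV, h, rfl⟩ := exists_specMat_eq hH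
  rw [exp_specMat hV, trace_specMat hV]
  exact Finset.sum_nonneg fun i _ => (Real.exp_pos _).le

/-- A Rayleigh quotient above t forces an eigenvalue above t, and the trace of the exponential
dominates each of its positive terms. This turns an operator deviation into a scalar one, at the
cost of the dimension factor. -/
lemma exp_le_trace_exp {H : Matrix η η ℝ} (hH : H.IsSymm) {t : ℝ} {z : η → ℝ}
    (hz : t * (z ⬝ᵥ z) < z ⬝ᵥ (H *ᵥ z)) : Real.exp t ≤ (NormedSpace.exp H).trace := by
  obtain ⟨V, hV, h, rfl⟩ := exists_specMat_eq hH
  rw [exp_specMat hV, trace_specMat hV]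
  obtain ⟨i, hi⟩ : ∃ i, t < h i := by
    by_contra! hcon
    rw [dotProduct_specMat, dotProduct_self_eq_sum hV, Finset.mul_sum] at hz
    exact absurd hz (not_lt.2 (Finset.sum_le_sum fun i _ =>
      mul_le_mul_of_nonneg_right (hcon i) (sq_nonneg _)))
  exact (Real.exp_le_exp.2 hi.le).trans
    (Finset.single_le_sum (f := fun i => Real.exp (h i)) (fun i _ => (Real.exp_pos _).le)
      (Finset.mem_univ i))

lemma isSymm_sum {α : Type*} (s : Finset α) {X : α → Matrix η η ℝ}
    (hX : ∀ x, (X x).IsSymm) : (∑ x ∈ s, X x).IsSymm := by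
  simpa using isSymm_sum_smul s (fun _ => (1 : ℝ)) hX

/-- The arbitrary symmetric Y makes the induction work: it absorbs the first draw while the others
are averaged, and afterwards the deterministic means of the others while the first draw is averaged.
-/
lemma sum_prod_trace_exp_le_fin {κ : Type*} [Fintype κ] {R : ℝ} (hR : 0 < R) (θ : ℝ) (N : ℕ)
    (p : Fin N → κ → ℝ) (hp : ∀ j i, 0 ≤ p j i) (hp1 : ∀ j, ∑ i, p j i = 1)
    (X : Fin N → κ → Matrix η η ℝ) (hX : ∀ j i, (X j i).IsSymm)
    (h0 : ∀ j i z, 0 ≤ z ⬝ᵥ (X j i *ᵥ z)) (hXR : ∀ j i z, z ⬝ᵥ (X j i *ᵥ z) ≤ R * (z ⬝ᵥ z))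
    (Y : Matrix η η ℝ) (hY : Y.IsSymm) :
    ∑ x : Fin N → κ, (∏ j, p j (x j)) *
        (NormedSpace.exp (Y + θ • ∑ j, X j (x j))).trace ≤
      (NormedSpace.exp (Y + ((Real.exp (θ * R) - 1) / R) •
        ∑ j, ∑ i, p j i • X j i)).trace := by
  induction N generalizing Y with
  | zero => simp
  | succ N ih =>
    set c := (Real.exp (θ * R) - 1) / R
    have hE : ∀ j, (∑ i, p j i • X j i).IsSymm := fun j => isSymm_sum_smul _ _ (hX j)
    rw [← (Fin.consEquiv fun _ => κ).sum_comp, Fintype.sum_prod_type]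
    simp only [Fin.consEquiv_apply, Fin.prod_univ_succ, Fin.sum_univ_succ, Fin.cons_zero,
      Fin.cons_succ]
    calc ∑ a, ∑ f : Fin N → κ, p 0 a * (∏ j : Fin N, p j.succ (f j)) *
          (NormedSpace.exp (Y + θ • (X 0 a + ∑ j : Fin N, X j.succ (f j)))).trace
        = ∑ a, p 0 a * ∑ f : Fin N → κ, (∏ j : Fin N, p j.succ (f j)) *
          (NormedSpace.exp ((Y + θ • X 0 a) + θ • ∑ j : Fin N, X j.succ (f j))).trace := by
          simp only [Finset.mul_sum, smul_add, add_assoc, mul_assoc]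
      _ ≤ ∑ a, p 0 a * (NormedSpace.exp ((Y + θ • X 0 a) + c •
          ∑ j : Fin N, ∑ i, p j.succ i • X j.succ i)).trace := by
          refine Finset.sum_le_sum fun a _ => mul_le_mul_of_nonneg_left ?_ (hp 0 a)
          exact ih (fun j => p j.succ) (fun j => hp j.succ) (fun j => hp1 j.succ)
            (fun j => X j.succ) (fun j => hX j.succ) (fun j => h0 j.succ) (fun j => hXR j.succ) _
            (hY.add ((hX 0 a).smul θ))
      _ = ∑ a, p 0 a * (NormedSpace.exp ((Y + c •
          ∑ j : Fin N, ∑ i, p j.succ i • X j.succ i) + θ • X 0 a)).trace := by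
          simp only [add_right_comm]
      _ ≤ (NormedSpace.exp ((Y + c • ∑ j : Fin N, ∑ i, p j.succ i • X j.succ i) +
          c • ∑ i, p 0 i • X 0 i)).trace :=
          sum_trace_exp_add_smul_le Finset.univ (hp 0) (hp1 0)
            (hY.add ((isSymm_sum _ fun j => hE (Fin.succ j)).smul c)) (hX 0) hR θ (h0 0) (hXR 0)
      _ = _ := by
          rw [smul_add, add_right_comm, add_assoc]

/-- The trace exponential moment bound for a sum of independent positive semidefinite matrices
whose expectations sum to the identity. -/
lemma sum_prod_trace_exp_le {ι κ : Type*} [Fintype ι] [DecidableEq ι] [Fintype κ] {R : ℝ}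
    (hR : 0 < R) (θ : ℝ)
    (p : ι → κ → ℝ) (hp : ∀ j i, 0 ≤ p j i) (hp1 : ∀ j, ∑ i, p j i = 1)
    (X : ι → κ → Matrix η η ℝ) (hX : ∀ j i, (X j i).IsSymm)
    (h0 : ∀ j i z, 0 ≤ z ⬝ᵥ (X j i *ᵥ z)) (hXR : ∀ j i z, z ⬝ᵥ (X j i *ᵥ z) ≤ R * (z ⬝ᵥ z))
    (hE : ∑ j, ∑ i, p j i • X j i = 1) :
    ∑ x : ι → κ, (∏ j, p j (x j)) * (NormedSpace.exp (θ • ∑ j, X j (x j))).trace ≤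
      Fintype.card η * Real.exp ((Real.exp (θ * R) - 1) / R) := by
  let e := Fintype.equivFin ι
  have h := sum_prod_trace_exp_le_fin hR θ (Fintype.card ι) (fun j => p (e.symm j))
    (fun j => hp _) (fun j => hp1 _) (fun j => X (e.symm j)) (fun j => hX _) (fun j => h0 _)
    (fun j => hXR _) 0 Matrix.isSymm_zero
  rw [e.symm.sum_comp (fun j => ∑ i, p j i • X j i), hE, zero_add, trace_exp_smul_one] at h
  refine le_of_eq_of_le ?_ h
  refine Fintype.sum_equiv (e.arrowCongr (Equiv.refl κ)) _ _ fun x => ?_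
  simp only [zero_add, Equiv.arrowCongr_apply, Equiv.coe_refl, Function.comp_apply, id_eq]
  rw [e.symm.prod_comp (fun j => p j (x j)), e.symm.sum_comp (fun j => X j (x j))]

/-- Markov's inequality for a function of finitely many independent discrete variables. -/
lemma IsIndependentDraw.measureReal_le {Ω ι κ : Type*} [MeasurableSpace Ω] [Fintype ι]
    [DecidableEq ι] [Fintype κ] [MeasurableSpace κ] [MeasurableSingletonClass κ] {μ : Measure Ω}
    [IsProbabilityMeasure μ] {p : ι → κ → ℝ} {ω : ι → Ω → κ} (hω : IsIndependentDraw μ p ω)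
    (bad : (ι → κ) → Prop) (F : (ι → κ) → ℝ) (hF : ∀ x, 0 ≤ F x) (hbad : ∀ x, bad x → 1 ≤ F x) :
    μ.real {w | bad fun j => ω j w} ≤ ∑ x, (∏ j, p j (x j)) * F x := by
  classical
  have hatom : ∀ x : ι → κ, μ.real (⋂ j, ω j ⁻¹' {x j}) = ∏ j, p j (x j) := fun x => by
    have h := hω.indep.measure_inter_preimage_eq_mul Finset.univ (sets := fun j => {x j})
      (fun j _ => measurableSet_singleton _)
    simp only [Finset.mem_univ, Set.iInter_true] at h
    rw [measureReal_def, h, ENNReal.toReal_prod]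
    exact Finset.prod_congr rfl fun j _ => hω.law j (x j)
  have hnn : ∀ x : ι → κ, 0 ≤ ∏ j, p j (x j) := fun x => by
    rw [← hatom]; exact measureReal_nonneg
  -- The bad event is only covered by measurable atoms, so subadditivity suffices and its own
  -- measurability is never needed.
  have hsub : {w | bad fun j => ω j w} ⊆
      ⋃ x ∈ Finset.univ.filter bad, ⋂ j, ω j ⁻¹' {x j} := fun w hw => by
    simp only [Set.mem_iUnion]
    exact ⟨fun j => ω j w, by simpa using hw, by simp⟩
  calc μ.real {w | bad fun j => ω j w}
      ≤ μ.real (⋃ x ∈ Finset.univ.filter bad, ⋂ j, ω j ⁻¹' {x j}) :=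
        measureReal_mono hsub (measure_ne_top _ _)
    _ ≤ ∑ x ∈ Finset.univ.filter bad, μ.real (⋂ j, ω j ⁻¹' {x j}) :=
        measureReal_biUnion_finset_le _ _
    _ ≤ ∑ x ∈ Finset.univ.filter bad, (∏ j, p j (x j)) * F x :=
        Finset.sum_le_sum fun x hx => by
          rw [hatom]
          exact le_mul_of_one_le_right (hnn x) (hbad x (Finset.mem_filter.1 hx).2)
    _ ≤ ∑ x, (∏ j, p j (x j)) * F x :=
        Finset.sum_le_sum_of_subset_of_nonneg (Finset.filter_subset _ _)
          fun x _ _ => mul_nonneg (hnn x) (hF x)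

/-- From log(1+δ) ≥ 2δ/(2+δ); after clearing denominators the remaining gap is δ²(1-δ)/3, which is
where δ < 1 enters. -/
lemma upper_exponent {δ : ℝ} (h0 : 0 < δ) (h1 : δ < 1) :
    -(Real.log (1 + δ) * (1 + δ)) + δ ≤ -(δ ^ 2 / 3) := by
  have h := Real.le_log_one_add_of_nonneg h0.le
  have h2 := mul_le_mul_of_nonneg_right h (by linarith : 0 ≤ 1 + δ)
  have h3 : δ + δ ^ 2 / 3 ≤ 2 * δ / (δ + 2) * (1 + δ) := by
    rw [div_mul_eq_mul_div, le_div_iff₀ (by linarith)]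
    nlinarith [mul_pos (mul_pos h0 h0) (sub_pos.2 h1)]
  linarith

/-- The stronger constant 1/2 holds here: after adding x²/2 the left side vanishes at 0 and has
derivative log(1-x) + x ≤ 0. It is weakened to 1/3 so that both tails share one exponent. -/
lemma lower_exponent {δ : ℝ} (h0 : 0 < δ) (h1 : δ < 1) :
    -(Real.log (1 - δ) * (1 - δ)) - δ ≤ -(δ ^ 2 / 3) := by
  have hs : 0 < 1 - δ := by linarith
  have hanti : AntitoneOn (fun x : ℝ => -(Real.log (1 - x) * (1 - x)) - x + x ^ 2 / 2)
      (Set.Icc 0 δ) := by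
    refine antitoneOn_of_deriv_nonpos (convex_Icc 0 δ) ?_ ?_ ?_
    · have : ContinuousOn (fun x : ℝ => Real.log (1 - x)) (Set.Icc 0 δ) :=
        ContinuousOn.log (by fun_prop) fun x hx => by linarith [hx.2]
      fun_prop
    · rw [interior_Icc]
      intro x hx
      have hx1 : (1 : ℝ) - x ≠ 0 := by linarith [hx.2]
      fun_prop (disch := assumption)
    · rw [interior_Icc]
      intro x hx
      have hx1 : 0 < 1 - x := by linarith [hx.2]
      have d1 : HasDerivAt (fun x : ℝ => 1 - x) (-1) x := (hasDerivAt_id x).const_sub 1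
      have d2 := (((d1.log hx1.ne').mul d1).neg.sub (hasDerivAt_id x)).add
        (((hasDerivAt_id x).pow 2).div_const 2)
      have d3 : HasDerivAt (fun x : ℝ => -(Real.log (1 - x) * (1 - x)) - x + x ^ 2 / 2)
          (Real.log (1 - x) + x) x := by
        refine d2.congr_deriv ?_
        simp
        field_simp
        ring
      rw [d3.deriv]
      linarith [Real.log_le_sub_one_of_pos hx1]
  have h := hanti (Set.left_mem_Icc.2 h0.le) (Set.right_mem_Icc.2 h0.le) h0.le
  simp at h
  nlinarith

/-- The matrix Chernoff inequality. -/
theorem matrix_chernoff {Ω ι κ : Type*} [MeasurableSpace Ω] [Fintype ι] [DecidableEq ι]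
    [Fintype κ] [MeasurableSpace κ] [MeasurableSingletonClass κ] {μ : Measure Ω}
    [IsProbabilityMeasure μ] {p : ι → κ → ℝ} {ω : ι → Ω → κ} (hω : IsIndependentDraw μ p ω)
    (hp : ∀ j, IsPosDistribution (p j)) {R δ : ℝ} (hR : 0 < R) (hδ : δ ∈ Set.Ioo (0 : ℝ) 1)
    (X : ι → κ → Matrix η η ℝ) (hX : ∀ j i, (X j i).IsSymm)
    (h0 : ∀ j i z, 0 ≤ z ⬝ᵥ (X j i *ᵥ z)) (hXR : ∀ j i z, z ⬝ᵥ (X j i *ᵥ z) ≤ R * (z ⬝ᵥ z))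
    (hE : ∑ j, ∑ i, p j i • X j i = 1) :
    1 - 2 * Fintype.card η * Real.exp (-(δ ^ 2 / (3 * R))) ≤
      μ.real {w | ∀ z, (1 - δ) * (z ⬝ᵥ z) ≤ z ⬝ᵥ ((∑ j, X j (ω j w)) *ᵥ z) ∧
        z ⬝ᵥ ((∑ j, X j (ω j w)) *ᵥ z) ≤ (1 + δ) * (z ⬝ᵥ z)} := by
  obtain ⟨hδ0, hδ1⟩ := hδ
  let good : (ι → κ) → Prop := fun x => ∀ z, (1 - δ) * (z ⬝ᵥ z) ≤ z ⬝ᵥ ((∑ j, X j (x j)) *ᵥ z) ∧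
        z ⬝ᵥ ((∑ j, X j (x j)) *ᵥ z) ≤ (1 + δ) * (z ⬝ᵥ z)
  -- These parameters minimize the two exponents -θ(1±δ) + (exp(θR) - 1)/R. The one for the lower
  -- tail is negative, so multiplying by it reverses the deviation inequality.
  let θ₁ := Real.log (1 + δ) / R
  let θ₂ := Real.log (1 - δ) / R
  have hθ₁ : 0 < θ₁ := div_pos (Real.log_pos (by linarith)) hR
  have hθ₂ : θ₂ < 0 := div_neg_of_neg_of_pos (Real.log_neg (by linarith) (by linarith)) hR
  let F : ℝ → ℝ → (ι → κ) → ℝ := fun θ τ x =>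
    Real.exp (-(θ * τ)) * (NormedSpace.exp (θ • ∑ j, X j (x j))).trace
  have hS : ∀ (θ : ℝ) (x : ι → κ), (θ • ∑ j, X j (x j)).IsSymm := fun θ x =>
    (isSymm_sum _ fun j => hX j (x j)).smul θ
  have hF : ∀ θ τ x, 0 ≤ F θ τ x := fun θ τ x =>
    mul_nonneg (Real.exp_pos _).le (trace_exp_nonneg (hS θ x))
  have hF1 : ∀ θ τ x z, θ * (τ * (z ⬝ᵥ z)) < θ * (z ⬝ᵥ ((∑ j, X j (x j)) *ᵥ z)) →
      1 ≤ F θ τ x := fun θ τ x z hz => by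
    have h := exp_le_trace_exp (hS θ x) (t := θ * τ) (z := z) (by
      rw [Matrix.smul_mulVec, dotProduct_smul, smul_eq_mul, mul_assoc]; exact hz)
    calc (1 : ℝ) = Real.exp (-(θ * τ)) * Real.exp (θ * τ) := by rw [← Real.exp_add]; simp
      _ ≤ _ := mul_le_mul_of_nonneg_left h (Real.exp_pos _).le
  have hsum : ∀ θ τ, ∑ x : ι → κ, (∏ j, p j (x j)) * F θ τ x ≤
      Fintype.card η * Real.exp (-(θ * τ) + (Real.exp (θ * R) - 1) / R) := fun θ τ => by
    have h := mul_le_mul_of_nonneg_left (sum_prod_trace_exp_le hR θ p (fun j i => ((hp j).pos i).le)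
      (fun j => (hp j).sum_eq_one) X hX h0 hXR hE) (Real.exp_pos (-(θ * τ))).le
    rw [Real.exp_add, mul_left_comm]
    refine le_of_eq_of_le ?_ h
    rw [Finset.mul_sum]
    exact Finset.sum_congr rfl fun x _ => mul_left_comm _ _ _
  have hbad := hω.measureReal_le (fun x => ¬ good x) (fun x => F θ₁ (1 + δ) x + F θ₂ (1 - δ) x)
    (fun x => add_nonneg (hF _ _ _) (hF _ _ _)) (fun x hx => by
      simp only [good, not_forall, not_and_or, not_le] at hx
      obtain ⟨z, hz | hz⟩ := hx
      · linarith [hF1 θ₂ (1 - δ) x z (mul_lt_mul_of_neg_left hz hθ₂), hF θ₁ (1 + δ) x]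
      · linarith [hF1 θ₁ (1 + δ) x z (mul_lt_mul_of_pos_left hz hθ₁), hF θ₂ (1 - δ) x])
  simp only [mul_add, Finset.sum_add_distrib] at hbad
  have e1 : Real.exp (-(θ₁ * (1 + δ)) + (Real.exp (θ₁ * R) - 1) / R) ≤
      Real.exp (-(δ ^ 2 / (3 * R))) := by
    rw [Real.exp_le_exp]
    have : θ₁ * R = Real.log (1 + δ) := div_mul_cancel₀ _ hR.ne'
    rw [this, Real.exp_log (by linarith)]
    have h := div_le_div_of_nonneg_right (upper_exponent hδ0 hδ1) hR.le
    calc _ = (-(Real.log (1 + δ) * (1 + δ)) + δ) / R := by simp only [θ₁]; ring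
      _ ≤ _ := h
      _ = _ := by field_simp
  have e2 : Real.exp (-(θ₂ * (1 - δ)) + (Real.exp (θ₂ * R) - 1) / R) ≤
      Real.exp (-(δ ^ 2 / (3 * R))) := by
    rw [Real.exp_le_exp]
    have : θ₂ * R = Real.log (1 - δ) := div_mul_cancel₀ _ hR.ne'
    rw [this, Real.exp_log (by linarith)]
    have h := div_le_div_of_nonneg_right (lower_exponent hδ0 hδ1) hR.le
    calc _ = (-(Real.log (1 - δ) * (1 - δ)) - δ) / R := by simp only [θ₂]; ring
      _ ≤ _ := h
      _ = _ := by field_simp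
  have hc : (0 : ℝ) ≤ Fintype.card η := Nat.cast_nonneg _
  have hb1 := (hsum θ₁ (1 + δ)).trans (mul_le_mul_of_nonneg_left e1 hc)
  have hb2 := (hsum θ₂ (1 - δ)).trans (mul_le_mul_of_nonneg_left e2 hc)
  -- Subadditivity over an event and its complement replaces the complement formula, which would
  -- require measurability.
  have hun : (1 : ℝ) ≤ μ.real {w | good fun j => ω j w} + μ.real {w | ¬ good fun j => ω j w} := by
    have h := measureReal_union_le (μ := μ) {w | good fun j => ω j w} {w | ¬ good fun j => ω j w}
    have hu : {w | good fun j => ω j w} ∪ {w | ¬ good fun j => ω j w} = Set.univ := by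
      ext w; simp [em]
    rwa [hu, probReal_univ] at h
  have : 1 - 2 * Fintype.card η * Real.exp (-(δ ^ 2 / (3 * R))) ≤
      μ.real {w | good fun j => ω j w} := by linarith
  exact this

end Chernoff

/-! ### Stability of least squares, deterministically. -/

section LeastSquares

lemma l2norm_nonneg {ι : Type*} [Fintype ι] (v : ι → ℝ) : 0 ≤ l2norm v := norm_nonneg _

lemma l2norm_sq {ι : Type*} [Fintype ι] (v : ι → ℝ) : l2norm v ^ 2 = v ⬝ᵥ v := by
  rw [l2norm, EuclideanSpace.norm_sq_eq]
  simp [dotProduct, sq]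

lemma l2norm_eq_zero {ι : Type*} [Fintype ι] {v : ι → ℝ} : l2norm v = 0 ↔ v = 0 := by
  rw [l2norm, norm_eq_zero, WithLp.toLp_eq_zero]

/-- The reweighted measurements of the space-time field of a signal, as a linear map. -/
noncomputable def measurement {n T : ℕ} {M : Type*} [Fintype M] [DecidableEq M]
    (A : Matrix (Fin n) (Fin n) ℝ) (S : Matrix M (Fin T × Fin n) ℝ) (P W : Matrix M M ℝ) :
    (Fin n → ℝ) →ₗ[ℝ] EuclideanSpace ℝ M where
  toFun z := WithLp.toLp 2 (reweight P W (S *ᵥ diffusionField A T z))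
  map_add' x y := by
    have : diffusionField A T (x + y) = diffusionField A T x + diffusionField A T y := by
      funext q; simp [diffusionField, Matrix.mulVec_add]
    rw [this, Matrix.mulVec_add, reweight, Matrix.mulVec_add]
    rfl
  map_smul' c x := by
    have : diffusionField A T (c • x) = c • diffusionField A T x := by
      funext q; simp [diffusionField, Matrix.mulVec_smul]
    rw [this, Matrix.mulVec_smul, reweight, Matrix.mulVec_smul]
    rfl

lemma l2norm_reweight_sub {n T : ℕ} {M : Type*} [Fintype M] [DecidableEq M]
    (A : Matrix (Fin n) (Fin n) ℝ) (S : Matrix M (Fin T × Fin n) ℝ) (P W : Matrix M M ℝ)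
    (z : Fin n → ℝ) (y : M → ℝ) :
    l2norm (reweight P W (S *ᵥ diffusionField A T z - y)) =
      ‖measurement A S P W z - WithLp.toLp 2 (reweight P W y)‖ := by
  rw [l2norm, reweight, Matrix.mulVec_sub]
  rfl

/-- Existence and uniqueness of minimizers of `‖Φ z - u‖` over a subspace on which `Φ` is
injective. -/
lemma existsUnique_minimizer {F G : Type*} [AddCommGroup F] [Module ℝ F] [FiniteDimensional ℝ F]
    [NormedAddCommGroup G] [InnerProductSpace ℝ G] (E : Submodule ℝ F) (Φ : F →ₗ[ℝ] G)
    (hinj : ∀ z ∈ E, Φ z = 0 → z = 0) (u : G) :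
    ∃! x, x ∈ E ∧ ∀ z ∈ E, ‖Φ x - u‖ ≤ ‖Φ z - u‖ := by
  have hfin : FiniteDimensional ℝ (E.map Φ) := inferInstance
  obtain ⟨v, hv, hmin⟩ := (E.map Φ).exists_norm_eq_iInf_of_complete_subspace
    (Submodule.complete_of_finiteDimensional _) u
  obtain ⟨x, hx, rfl⟩ := hv
  refine ⟨x, ⟨hx, fun z hz => ?_⟩, ?_⟩
  · rw [norm_sub_rev, hmin, norm_sub_rev]
    exact ciInf_le ⟨0, by rintro _ ⟨w, rfl⟩; exact norm_nonneg _⟩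
      (⟨Φ z, Submodule.mem_map_of_mem hz⟩ : E.map Φ)
  · rintro y ⟨hy, hymin⟩
    have hxmin : ∀ z ∈ E, ‖Φ x - u‖ ≤ ‖Φ z - u‖ := fun z hz => by
      rw [norm_sub_rev, hmin, norm_sub_rev]
      exact ciInf_le ⟨0, by rintro _ ⟨w, rfl⟩; exact norm_nonneg _⟩
        (⟨Φ z, Submodule.mem_map_of_mem hz⟩ : E.map Φ)
    have heq : ‖Φ y - u‖ = ‖Φ x - u‖ := le_antisymm (hymin x hx) (hxmin y hy)
    -- Two minimizers have the same residual norm. Their midpoint cannot have a smaller one, so the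
    -- parallelogram law forces equal images, and injectivity on E gives equality.
    have hmid := hxmin ((2⁻¹ : ℝ) • (y + x)) (E.smul_mem _ (E.add_mem hy hx))
    have hm : Φ ((2⁻¹ : ℝ) • (y + x)) - u = (2⁻¹ : ℝ) • ((Φ y - u) + (Φ x - u)) := by
      rw [map_smul, map_add]; module
    rw [hm, norm_smul, Real.norm_of_nonneg (by norm_num)] at hmid
    have hpar := parallelogram_law_with_norm ℝ (Φ y - u) (Φ x - u)
    rw [heq, sub_sub_sub_cancel_right] at hpar
    have h0 : ‖Φ y - Φ x‖ = 0 := by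
      have := norm_nonneg (Φ x - u)
      have : ‖Φ y - Φ x‖ * ‖Φ y - Φ x‖ ≤ 0 := by nlinarith
      exact mul_self_eq_zero.1 (le_antisymm this (mul_self_nonneg _))
    rw [norm_eq_zero, ← map_sub] at h0
    exact sub_eq_zero.1 (hinj _ (E.sub_mem hy hx) h0)

/-- The lower bound `α` gives injectivity, hence a unique minimizer, and converts a residual
estimate into an error estimate. The upper bound `β` is used only to show that some noise is not
damped. -/
lemma errorBounds_of_stable {n T : ℕ} {M : Type*} [Fintype M] [DecidableEq M]
    {E : Submodule ℝ (Fin n → ℝ)} {A : Matrix (Fin n) (Fin n) ℝ}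
    {S : Matrix M (Fin T × Fin n) ℝ} {P W : Matrix M M ℝ} {α β : ℝ} (hα : 0 < α) (hβ : 0 < β)
    (hE : ∃ z ∈ E, z ≠ 0)
    (hlow : ∀ z ∈ E, α * l2norm z ≤ ‖measurement A S P W z‖)
    (hup : ∀ z ∈ E, ‖measurement A S P W z‖ ≤ β * l2norm z) :
    ErrorBounds E A S P W (2 / α) (1 / β) := by
  set Φ := measurement A S P W with hΦ
  have hinj : ∀ z ∈ E, Φ z = 0 → z = 0 := fun z hz h0 => by
    have h := hlow z hz
    rw [h0, norm_zero] at h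
    have := l2norm_nonneg z
    exact l2norm_eq_zero.1 (by nlinarith)
  have hLS : ∀ y x', IsLeastSquares E A S P W y x' ↔ x' ∈ E ∧ ∀ z ∈ E,
      ‖Φ x' - WithLp.toLp 2 (reweight P W y)‖ ≤ ‖Φ z - WithLp.toLp 2 (reweight P W y)‖ :=
    fun y x' => by simp only [IsLeastSquares, l2norm_reweight_sub, ← hΦ]
  have hdata : ∀ (x : Fin n → ℝ) (e : M → ℝ),
      WithLp.toLp 2 (reweight P W (S *ᵥ diffusionField A T x + e)) =
        Φ x + WithLp.toLp 2 (reweight P W e) := fun x e => by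
    rw [reweight, Matrix.mulVec_add]; rfl
  intro x hx
  refine ⟨fun e => ⟨?_, fun x' hx' => ?_⟩, ?_⟩
  · simp only [hLS]
    exact existsUnique_minimizer E Φ hinj _
  · rw [hLS, hdata] at hx'
    have h1 := hx'.2 x hx
    rw [sub_add_cancel_left, norm_neg] at h1
    have h2 : ‖Φ (x' - x)‖ ≤ 2 * l2norm (reweight P W e) := by
      -- The residual at the minimizer is at most the residual at the true signal, which is the
      -- weighted noise; the noise is thus counted twice, giving the constant 2.
      have e1 : Φ (x' - x) = (Φ x' - (Φ x + WithLp.toLp 2 (reweight P W e))) +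
          WithLp.toLp 2 (reweight P W e) := by rw [map_sub]; abel
      rw [e1]
      refine (norm_add_le _ _).trans ?_
      rw [l2norm]
      linarith
    have h3 := hlow _ (E.sub_mem hx'.1 hx)
    rw [div_mul_eq_mul_div, le_div_iff₀ hα]
    linarith
  · obtain ⟨x₀, hx₀, hne⟩ := hE
    have hΦ₀ : Φ x₀ = WithLp.toLp 2 (reweight P W (S *ᵥ diffusionField A T x₀)) := rfl
    -- With this noise the data are the noiseless samples of x + x₀, so the residual can be zero and
    -- the solution is x + x₀ exactly.
    refine ⟨S *ᵥ diffusionField A T x₀, fun h0 => hne (hinj x₀ hx₀ ?_), fun x' hx' => ?_⟩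
    · rw [hΦ₀, h0, reweight, Matrix.mulVec_zero, WithLp.toLp_zero]
    · rw [hLS, hdata, ← hΦ₀, ← map_add] at hx'
      have h1 := hx'.2 (x + x₀) (E.add_mem hx hx₀)
      rw [sub_self, norm_zero, norm_le_zero_iff, ← map_sub] at h1
      have h2 : x' = x + x₀ :=
        sub_eq_zero.1 (hinj _ (E.sub_mem hx'.1 (E.add_mem hx hx₀)) h1)
      rw [h2, add_sub_cancel_left, one_div, inv_mul_le_iff₀ hβ]
      exact hup x₀ hx₀

end LeastSquares

/-! ### The space-time basis and the passage from frames to error bounds. -/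

section SpaceTime

lemma sampledProb_apply {M N : Type*} [DecidableEq M] [Fintype N] [DecidableEq N]
    (loc : M → N) (p : N → ℝ) (r : M) :
    sampledProb (samplingMatrix loc) p r r = p (loc r) := by
  simp [sampledProb, samplingMatrix, Matrix.mul_apply, Matrix.diagonal_apply]

lemma samplingMatrix_mulVec {M N : Type*} [Fintype N] [DecidableEq N]
    (loc : M → N) (v : N → ℝ) : samplingMatrix loc *ᵥ v = v ∘ loc := by
  funext r
  simp [samplingMatrix, Matrix.mulVec, dotProduct]

lemma norm_measurement_sq {n T : ℕ} {M : Type*} [Fintype M] [DecidableEq M]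
    (A : Matrix (Fin n) (Fin n) ℝ) (loc : M → Fin T × Fin n) {q : Fin T × Fin n → ℝ}
    (hq : ∀ x, 0 < q x) {wt : M → ℝ} (hwt : ∀ r, 0 ≤ wt r) (z : Fin n → ℝ) :
    ‖measurement A (samplingMatrix loc) (sampledProb (samplingMatrix loc) q)
      (Matrix.diagonal wt) z‖ ^ 2 =
      ∑ r, wt r / q (loc r) * diffusionField A T z (loc r) ^ 2 := by
  have : ‖measurement A (samplingMatrix loc) (sampledProb (samplingMatrix loc) q)
      (Matrix.diagonal wt) z‖ = l2norm (reweight (sampledProb (samplingMatrix loc) q)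
        (Matrix.diagonal wt) (samplingMatrix loc *ᵥ diffusionField A T z)) := rfl
  rw [this, l2norm_sq, samplingMatrix_mulVec, dotProduct]
  refine Finset.sum_congr rfl fun r _ => ?_
  rw [reweight, ← Matrix.mulVec_mulVec, Matrix.mulVec_diagonal, Matrix.mulVec_diagonal,
    sampledProb_apply, Matrix.diagonal_apply_eq, Function.comp_apply]
  have h1 := Real.sq_sqrt (hq (loc r)).le
  have h2 := Real.sq_sqrt (hwt r)
  rw [div_eq_mul_inv]
  nth_rewrite 3 [← h2]
  nth_rewrite 3 [← h1]
  ring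

lemma fT_sq {T : ℕ} (l : ℝ) : fT T l ^ 2 = ∑ t ∈ Finset.range T, l ^ (2 * t) :=
  Real.sq_sqrt (Finset.sum_nonneg fun t _ => by rw [pow_mul]; positivity)

lemma fT_pos {T : ℕ} (hT : 1 ≤ T) (l : ℝ) : 0 < fT T l := by
  refine Real.sqrt_pos.2 (Finset.sum_pos' (fun t _ => by rw [pow_mul]; positivity)
    ⟨0, Finset.mem_range.2 hT, by simp⟩)

lemma fT_mono {T : ℕ} {l l' : ℝ} (h0 : 0 ≤ l) (h : l ≤ l') : fT T l ≤ fT T l' :=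
  Real.sqrt_le_sqrt (Finset.sum_le_sum fun _ _ => pow_le_pow_left₀ h0 h _)

lemma evolEigenvalue_pos {n : ℕ} (Δt : ℝ) (σ : Fin n → ℝ) (i : Fin n) :
    0 < evolEigenvalue Δt σ i := Real.exp_pos _

lemma evolEigenvalue_antitone {n : ℕ} {Δt : ℝ} (hΔt : 0 < Δt) {σ : Fin n → ℝ}
    (hσ : Monotone σ) : Antitone (evolEigenvalue Δt σ) := fun i j hij => by
  refine Real.exp_le_exp.2 ?_
  nlinarith [mul_le_mul_of_nonneg_left (hσ hij) hΔt.le]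

variable {n k T : ℕ} (hkn : k ≤ n) {Δt : ℝ} {U : Matrix (Fin n) (Fin n) ℝ} {σ : Fin n → ℝ}

lemma firstCols_transpose_mul (hU : U ∈ Matrix.orthogonalGroup (Fin n) ℝ) :
    (firstCols hkn U)ᵀ * firstCols hkn U = 1 := by
  have : (firstCols hkn U)ᵀ * firstCols hkn U =
      (Uᵀ * U).submatrix (Fin.castLE hkn) (Fin.castLE hkn) := by
    ext i j; simp [firstCols, Matrix.mul_apply]
  rw [this, orthogonal_transpose_mul hU]
  exact Matrix.submatrix_one _ (Fin.castLE_injective hkn)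

lemma l2norm_firstCols_mulVec (hU : U ∈ Matrix.orthogonalGroup (Fin n) ℝ) (a : Fin k → ℝ) :
    l2norm (firstCols hkn U *ᵥ a) ^ 2 = a ⬝ᵥ a := by
  rw [l2norm_sq, Matrix.dotProduct_mulVec, ← Matrix.mulVec_transpose, Matrix.mulVec_mulVec,
    firstCols_transpose_mul hkn hU, Matrix.one_mulVec]

lemma mem_bandlimited {z : Fin n → ℝ} :
    z ∈ bandlimited hkn U ↔ ∃ a, firstCols hkn U *ᵥ a = z := by
  rw [bandlimited, ← Matrix.range_mulVecLin, LinearMap.mem_range]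
  simp

lemma evolution_eq {G : WeightedGraph n} (hU : IsEigenDecomposition G.laplacian U σ) :
    G.evolution Δt = specMat U (evolEigenvalue Δt σ) := by
  have h : -Δt • G.laplacian = specMat U (fun i => -Δt * σ i) := by
    rw [specMat_smul, hU.decomp]; rfl
  rw [WeightedGraph.evolution, h, exp_specMat hU.orthogonal]
  rfl

lemma specMat_pow_mulVec_col (hU : U ∈ Matrix.orthogonalGroup (Fin n) ℝ) (a : Fin n → ℝ)
    (t : ℕ) (l : Fin n) : specMat U a ^ t *ᵥ U.col l = a l ^ t • U.col l := by
  induction t with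
  | zero => simp
  | succ t ih =>
    have h1 : specMat U a *ᵥ U.col l = a l • U.col l := by
      rw [specMat, ← Matrix.mulVec_mulVec, transpose_mulVec_col hU, ← Matrix.mulVec_mulVec,
        Matrix.diagonal_mulVec_single, mul_one]
      ext i
      simp [mul_comm]
    rw [pow_succ, ← Matrix.mulVec_mulVec, h1, Matrix.mulVec_smul, ih, smul_smul, pow_succ,
      mul_comm]

/-- Each u_ℓ is an eigenvector of every A^t. The factor f_T(λ_ℓ) cancels the normalization in the
columns of Ũ, and it is the source of f_T in the final constants. -/
lemma diffusionField_firstCols (hT : 1 ≤ T) {G : WeightedGraph n}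
    (hU : IsEigenDecomposition G.laplacian U σ) (a : Fin k → ℝ) :
    diffusionField (G.evolution Δt) T (firstCols hkn U *ᵥ a) =
      spaceTimeBasis hkn T Δt U σ *ᵥ
        fun l => fT T (evolEigenvalue Δt σ (Fin.castLE hkn l)) * a l := by
  funext q
  have hz : firstCols hkn U *ᵥ a = ∑ l, a l • U.col (Fin.castLE hkn l) := by
    ext i
    simp [firstCols, Matrix.mulVec, dotProduct, Finset.sum_apply, mul_comm]
  rw [diffusionField, hz, evolution_eq hU, Matrix.mulVec_sum, Finset.sum_apply]
  simp only [Matrix.mulVec_smul, specMat_pow_mulVec_col hU.orthogonal]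
  rw [Matrix.mulVec, dotProduct]
  refine Finset.sum_congr rfl fun l _ => ?_
  have := (fT_pos hT (evolEigenvalue Δt σ (Fin.castLE hkn l))).ne'
  simp only [spaceTimeBasis, firstCols, Matrix.of_apply, Matrix.submatrix_apply, id_eq,
    Pi.smul_apply, smul_eq_mul, Matrix.col_apply]
  field_simp

/-- If the sampled space-time basis is a frame with bounds `1 ± δ`, then the error bounds hold. -/
lemma errorBounds_of_frame (hk : 1 ≤ k) (hT : 1 ≤ T) {G : WeightedGraph n}
    (hΔt : 0 < Δt) (hU : IsEigenDecomposition G.laplacian U σ) {δ : ℝ}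
    (hδ : δ ∈ Set.Ioo (0 : ℝ) 1) {M : Type*} [Fintype M] [DecidableEq M]
    (loc : M → Fin T × Fin n) {q : Fin T × Fin n → ℝ} (hq : ∀ x, 0 < q x) {wt : M → ℝ}
    (hwt : ∀ r, 0 ≤ wt r)
    (hframe : ∀ b : Fin k → ℝ,
      (1 - δ) * (b ⬝ᵥ b) ≤
        ∑ r, wt r / q (loc r) * (spaceTimeBasis hkn T Δt U σ *ᵥ b) (loc r) ^ 2 ∧
      ∑ r, wt r / q (loc r) * (spaceTimeBasis hkn T Δt U σ *ᵥ b) (loc r) ^ 2 ≤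
        (1 + δ) * (b ⬝ᵥ b)) :
    ErrorBounds (bandlimited hkn U) (G.evolution Δt) (samplingMatrix loc)
      (sampledProb (samplingMatrix loc) q) (Matrix.diagonal wt)
      (2 / (√(1 - δ) * fT T (evolEigenvalue Δt σ ⟨k - 1, by omega⟩)))
      (1 / (√(1 + δ) * fT T (evolEigenvalue Δt σ ⟨0, by omega⟩))) := by
  have hf1 := fT_pos hT (evolEigenvalue Δt σ ⟨k - 1, by omega⟩)
  have hf0 := fT_pos hT (evolEigenvalue Δt σ ⟨0, by omega⟩)
  have hs1 : 0 < 1 - δ := by linarith [hδ.2]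
  have hs0 : 0 < 1 + δ := by linarith [hδ.1]
  have hanti := evolEigenvalue_antitone hΔt hU.monotone
  refine errorBounds_of_stable (mul_pos (Real.sqrt_pos.2 hs1) hf1)
    (mul_pos (Real.sqrt_pos.2 hs0) hf0) ?_ ?_ ?_
  · refine ⟨firstCols hkn U *ᵥ Pi.single ⟨0, hk⟩ 1, (mem_bandlimited hkn).2 ⟨_, rfl⟩, fun h0 => ?_⟩
    have h := l2norm_firstCols_mulVec hkn hU.orthogonal (Pi.single ⟨0, hk⟩ 1)
    rw [h0, l2norm_eq_zero.2 rfl] at h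
    simp at h
  · intro z hz
    obtain ⟨a, rfl⟩ := (mem_bandlimited hkn).1 hz
    refine (abs_le_of_sq_le_sq' ?_ (norm_nonneg _)).2
    rw [norm_measurement_sq _ _ hq hwt, diffusionField_firstCols hkn hT hU, mul_pow, mul_pow,
      Real.sq_sqrt hs1.le, l2norm_firstCols_mulVec hkn hU.orthogonal]
    refine le_trans ?_ (hframe _).1
    rw [mul_assoc]
    refine mul_le_mul_of_nonneg_left ?_ hs1.le
    simp only [dotProduct, Finset.mul_sum]
    refine Finset.sum_le_sum fun l _ => ?_
    -- Indices start at 0, so `k - 1` is the last index of the band; eigenvalues of A decrease while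
    -- those of L increase, so it carries the smallest f_T.
    have hm : fT T (evolEigenvalue Δt σ ⟨k - 1, by omega⟩) ≤
        fT T (evolEigenvalue Δt σ (Fin.castLE hkn l)) :=
      fT_mono (evolEigenvalue_pos _ _ _).le (hanti (Fin.mk_le_mk.2 (by omega)))
    have := mul_le_mul_of_nonneg_right (pow_le_pow_left₀ hf1.le hm 2) (mul_self_nonneg (a l))
    linarith
  · intro z hz
    obtain ⟨a, rfl⟩ := (mem_bandlimited hkn).1 hz
    refine (abs_le_of_sq_le_sq' ?_
      (mul_nonneg (mul_pos (Real.sqrt_pos.2 hs0) hf0).le (l2norm_nonneg _))).2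
    rw [norm_measurement_sq _ _ hq hwt, diffusionField_firstCols hkn hT hU, mul_pow, mul_pow,
      Real.sq_sqrt hs0.le, l2norm_firstCols_mulVec hkn hU.orthogonal]
    refine (hframe _).2.trans ?_
    rw [mul_assoc]
    refine mul_le_mul_of_nonneg_left ?_ hs0.le
    simp only [dotProduct, Finset.mul_sum]
    refine Finset.sum_le_sum fun l _ => ?_
    have hm : fT T (evolEigenvalue Δt σ (Fin.castLE hkn l)) ≤
        fT T (evolEigenvalue Δt σ ⟨0, by omega⟩) :=
      fT_mono (evolEigenvalue_pos _ _ _).le (hanti (Fin.mk_le_mk.2 (by omega)))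
    have := mul_le_mul_of_nonneg_right
      (pow_le_pow_left₀ (fT_pos hT _).le hm 2) (mul_self_nonneg (a l))
    linarith

/-- The rank-one matrix of a row of `V`. -/
def rowGram {N η : Type*} (V : Matrix N η ℝ) (q : N) : Matrix η η ℝ :=
  Matrix.vecMulVec (V q) (V q)

lemma rowGram_isSymm {N η : Type*} (V : Matrix N η ℝ) (q : N) : (rowGram V q).IsSymm := by
  ext i j; simp [rowGram, Matrix.vecMulVec_apply, mul_comm]

lemma dotProduct_rowGram {N η : Type*} [Fintype η] (V : Matrix N η ℝ) (q : N) (z : η → ℝ) :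
    z ⬝ᵥ (rowGram V q *ᵥ z) = (V *ᵥ z) q ^ 2 := by
  have : (V *ᵥ z) q = V q ⬝ᵥ z := rfl
  rw [this, rowGram, Matrix.vecMulVec_mulVec]
  simp [sq, dotProduct_comm]

/-- Within one time slice the factors λ_ℓ^t / f_T(λ_ℓ) do not depend on the vertex, so
orthonormality of the spatial columns already makes the Gram matrix diagonal. -/
lemma sum_rowGram_time (hU : U ∈ Matrix.orthogonalGroup (Fin n) ℝ) (t : Fin T) :
    ∑ i, rowGram (spaceTimeBasis hkn T Δt U σ) (t, i) =
      Matrix.diagonal fun l => (evolEigenvalue Δt σ (Fin.castLE hkn l) ^ (t : ℕ) /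
        fT T (evolEigenvalue Δt σ (Fin.castLE hkn l))) ^ 2 := by
  have h := firstCols_transpose_mul hkn hU
  ext l l'
  have hl := congrFun (congrFun h l) l'
  rw [Matrix.mul_apply] at hl
  simp only [Matrix.transpose_apply] at hl
  have e : (∑ i, rowGram (spaceTimeBasis hkn T Δt U σ) (t, i)) l l' =
      evolEigenvalue Δt σ (Fin.castLE hkn l) ^ (t : ℕ) /
          fT T (evolEigenvalue Δt σ (Fin.castLE hkn l)) *
        (evolEigenvalue Δt σ (Fin.castLE hkn l') ^ (t : ℕ) /
          fT T (evolEigenvalue Δt σ (Fin.castLE hkn l'))) *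
        ∑ i, firstCols hkn U i l * firstCols hkn U i l' := by
    rw [Matrix.sum_apply, Finset.mul_sum]
    exact Finset.sum_congr rfl fun i _ => mul_mul_mul_comm _ _ _ _
  rw [e]
  rw [hl, Matrix.diagonal_apply, Matrix.one_apply]
  split_ifs with hll
  · subst hll; ring
  · simp

/-- Summing the slices over t gives f_T(λ)² over f_T(λ)² on the diagonal. This is the source of the
identity expectation in all regimes. -/
lemma sum_rowGram (hT : 1 ≤ T) (hU : U ∈ Matrix.orthogonalGroup (Fin n) ℝ) :
    ∑ t, ∑ i, rowGram (spaceTimeBasis hkn T Δt U σ) (t, i) = 1 := by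
  simp only [sum_rowGram_time hkn hU]
  ext l l'
  rw [Matrix.sum_apply]
  simp only [Matrix.diagonal_apply, Matrix.one_apply]
  split_ifs with hll
  · have hf := (fT_pos hT (evolEigenvalue Δt σ (Fin.castLE hkn l))).ne'
    simp only [div_pow, ← Finset.sum_div]
    rw [div_eq_one_iff_eq (pow_ne_zero 2 hf), fT_sq, ← Fin.sum_univ_eq_sum_range
      (fun t => evolEigenvalue Δt σ (Fin.castLE hkn l) ^ (2 * t))]
    exact Finset.sum_congr rfl fun t _ => by rw [← pow_mul, mul_comm]
  · simp

/-- As λ > 0, no time slice vanishes. Hence the coherences are nonzero and the sample sizes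
positive; otherwise a weight 1/m could be 1/0 = 0 and the expectation would not be the identity. -/
lemma exists_spaceTimeBasis_ne_zero (hk : 1 ≤ k) (hT : 1 ≤ T)
    (hU : U ∈ Matrix.orthogonalGroup (Fin n) ℝ) (t : Fin T) :
    ∃ i, ∃ z, (spaceTimeBasis hkn T Δt U σ *ᵥ z) (t, i) ≠ 0 := by
  by_contra! hcon
  have h := congrArg (fun B => (Pi.single ⟨0, hk⟩ 1 : Fin k → ℝ) ⬝ᵥ
    (B *ᵥ Pi.single ⟨0, hk⟩ 1)) (sum_rowGram_time (Δt := Δt) (σ := σ) hkn hU t)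
  simp only [Matrix.sum_mulVec, dotProduct_sum, dotProduct_rowGram, hcon] at h
  have hl := evolEigenvalue_pos Δt σ (Fin.castLE hkn ⟨0, hk⟩)
  have hf := fT_pos hT (evolEigenvalue Δt σ (Fin.castLE hkn ⟨0, hk⟩))
  simp only [ne_eq, OfNat.ofNat_ne_zero, not_false_eq_true, zero_pow, Finset.sum_const_zero,
    Matrix.mulVec_single_one, single_dotProduct, Matrix.col_apply, Matrix.diagonal_apply_eq,
    one_mul] at h
  exact (pow_pos (div_pos (pow_pos hl _) hf) 2).ne h

end SpaceTime

/-! ### From Chernoff to error bounds with high probability. -/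

section Sampling

variable {n k T : ℕ} (hkn : k ≤ n) {Δt : ℝ} {U : Matrix (Fin n) (Fin n) ℝ} {σ : Fin n → ℝ}

lemma log_two_mul_div_pos (hk : 1 ≤ k) {ε : ℝ} (hε : ε ∈ Set.Ioo (0 : ℝ) 1) :
    0 < Real.log (2 * k / ε) := by
  refine Real.log_pos ((one_lt_div hε.1).2 ?_)
  have : (1 : ℝ) ≤ k := by exact_mod_cast hk
  linarith [hε.2]

/-- The error bounds hold with high probability as soon as the sampled space-time basis is a sum
of independent bounded positive semidefinite matrices with the correct expectation. -/
lemma errorBounds_probability (hk : 1 ≤ k) (hT : 1 ≤ T) {G : WeightedGraph n}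
    (hΔt : 0 < Δt) (hU : IsEigenDecomposition G.laplacian U σ) {ε δ : ℝ}
    (hε : ε ∈ Set.Ioo (0 : ℝ) 1) (hδ : δ ∈ Set.Ioo (0 : ℝ) 1)
    {Ω ι κ : Type*} [MeasurableSpace Ω] [Fintype ι] [DecidableEq ι]
    [Fintype κ] [MeasurableSpace κ] [MeasurableSingletonClass κ] {μ : Measure Ω}
    [IsProbabilityMeasure μ] {p : ι → κ → ℝ} {ω : ι → Ω → κ} (hω : IsIndependentDraw μ p ω)
    (hp : ∀ j, IsPosDistribution (p j))
    (X : ι → κ → Matrix (Fin k) (Fin k) ℝ) (hX : ∀ j i, (X j i).IsSymm)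
    (h0 : ∀ j i z, 0 ≤ z ⬝ᵥ (X j i *ᵥ z))
    (hXR : ∀ j i z, z ⬝ᵥ (X j i *ᵥ z) ≤ δ ^ 2 / (3 * Real.log (2 * k / ε)) * (z ⬝ᵥ z))
    (hE : ∑ j, ∑ i, p j i • X j i = 1)
    {M : Type*} [Fintype M] [DecidableEq M] (loc : (ι → κ) → M → Fin T × Fin n)
    {q : Fin T × Fin n → ℝ} (hq : ∀ x, 0 < q x) {wt : M → ℝ} (hwt : ∀ r, 0 ≤ wt r)
    (hloc : ∀ x z, z ⬝ᵥ ((∑ j, X j (x j)) *ᵥ z) = ∑ r, wt r / q (loc x r) *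
      (spaceTimeBasis hkn T Δt U σ *ᵥ z) (loc x r) ^ 2) :
    1 - ε ≤ μ.real {w | ErrorBounds (bandlimited hkn U) (G.evolution Δt)
      (samplingMatrix (loc fun j => ω j w))
      (sampledProb (samplingMatrix (loc fun j => ω j w)) q) (Matrix.diagonal wt)
      (2 / (√(1 - δ) * fT T (evolEigenvalue Δt σ ⟨k - 1, by omega⟩)))
      (1 / (√(1 + δ) * fT T (evolEigenvalue Δt σ ⟨0, by omega⟩)))} := by
  have hL := log_two_mul_div_pos hk hε
  have hδ0 := hδ.1
  have h := matrix_chernoff hω hp (R := δ ^ 2 / (3 * Real.log (2 * k / ε))) (by positivity) hδ X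
    hX h0 hXR hE
  have hk0 : (0 : ℝ) < k := by exact_mod_cast hk
  -- For this R the Chernoff exponent is exactly -log(2k/ε), and the factor 2k for both tails in
  -- dimension k then leaves ε.
  have e1 : -(δ ^ 2 / (3 * (δ ^ 2 / (3 * Real.log (2 * k / ε))))) = -Real.log (2 * k / ε) := by
    field_simp
  have e2 : 2 * (Fintype.card (Fin k) : ℝ) * Real.exp (-Real.log (2 * k / ε)) = ε := by
    have := hε.1
    rw [Real.exp_neg, Real.exp_log (by positivity), Fintype.card_fin]
    field_simp
  rw [e1, e2] at h
  refine h.trans (measureReal_mono (fun w hw => ?_) (measure_ne_top _ _))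
  refine errorBounds_of_frame hkn hk hT hΔt hU hδ _ hq hwt fun b => ?_
  rw [← hloc]
  exact hw b

lemma dotProduct_smul_mulVec (c : ℝ) (X : Matrix (Fin k) (Fin k) ℝ) (z : Fin k → ℝ) :
    z ⬝ᵥ ((c • X) *ᵥ z) = c * (z ⬝ᵥ (X *ᵥ z)) := by
  rw [Matrix.smul_mulVec, dotProduct_smul, smul_eq_mul]

/-! ### Coherence as a bound on the random summands. -/

/-- Cauchy-Schwarz for a row of a matrix. -/
lemma sq_mulVec_le_l2norm {N : Type*} [Fintype N] [DecidableEq N] (V : Matrix N (Fin k) ℝ) (q : N)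
    (z : Fin k → ℝ) :
    (V *ᵥ z) q ^ 2 ≤ l2norm (Vᵀ *ᵥ Pi.single q 1) ^ 2 * (z ⬝ᵥ z) := by
  rw [l2norm_sq, Matrix.mulVec_single_one]
  have h := Finset.sum_mul_sq_le_sq_mul_sq Finset.univ (V q) z
  simpa [Matrix.mulVec, dotProduct, sq] using h

lemma sum_sq_mulVec_le_opNorm {N : Type*} [Fintype N] (B : Matrix N (Fin k) ℝ)
    (z : Fin k → ℝ) : ∑ t, (B *ᵥ z) t ^ 2 ≤ opNorm B ^ 2 * (z ⬝ᵥ z) := by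
  have h := Matrix.l2_opNorm_mulVec B (WithLp.toLp 2 z)
  have h2 := pow_le_pow_left₀ (norm_nonneg _) h 2
  rw [mul_pow] at h2
  have e1 : ‖WithLp.toLp 2 z‖ ^ 2 = z ⬝ᵥ z := l2norm_sq z
  have e2 : ‖(EuclideanSpace.equiv N ℝ).symm (B *ᵥ (WithLp.toLp 2 z).ofLp)‖ ^ 2 =
    ∑ t, (B *ᵥ z) t ^ 2 := by
      refine (l2norm_sq (B *ᵥ z)).trans ?_
      simp [dotProduct, sq]
  rw [e1, e2] at h2
  exact h2

/-- Passing from the weighted norm of a block to a coherence. -/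
lemma le_of_coherence {κ : Type*} [Finite κ] {p ρ : κ → ℝ} (hp : ∀ i, 0 < p i)
    (hρ : ∀ i, 0 ≤ ρ i) {ν : ℝ} (hν : ν = ⨆ i, 1 / √(p i) * ρ i) (i : κ) :
    ρ i ^ 2 ≤ p i * ν ^ 2 := by
  have h : 1 / √(p i) * ρ i ≤ ν := by
    rw [hν]
    exact le_ciSup (f := fun i => 1 / √(p i) * ρ i) (Set.finite_range _).bddAbove i
  have hs := Real.sqrt_pos.2 (hp i)
  have h1 : ρ i ≤ √(p i) * ν := by
    rwa [one_div, inv_mul_le_iff₀ hs] at h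
  have h2 := pow_le_pow_left₀ (hρ i) h1 2
  rwa [mul_pow, Real.sq_sqrt (hp i).le] at h2

open scoped Matrix.Norms.L2Operator in
lemma opNorm_nonneg {N : Type*} [Fintype N] (B : Matrix N (Fin k) ℝ) : 0 ≤ opNorm B :=
  norm_nonneg B

lemma sum_sq_mulVec_le_coherence₁ (V : Matrix (Fin T × Fin n) (Fin k) ℝ) {p : Fin n → ℝ}
    (hp : ∀ i, 0 < p i) (i : Fin n) (z : Fin k → ℝ) :
    ∑ t, (V *ᵥ z) (t, i) ^ 2 ≤ p i * coherence₁ V p ^ 2 * (z ⬝ᵥ z) := by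
  have h := le_of_coherence (ρ := fun i => opNorm (V.submatrix (fun t : Fin T => (t, i)) id)) hp
    (fun i => opNorm_nonneg _) (ν := coherence₁ V p) rfl i
  refine (sum_sq_mulVec_le_opNorm (V.submatrix (fun t : Fin T => (t, i)) id) z).trans ?_
  exact mul_le_mul_of_nonneg_right h (by rw [← l2norm_sq]; positivity)

lemma sq_mulVec_le_coherence₂ (V : Matrix (Fin T × Fin n) (Fin k) ℝ) {p : Fin T → Fin n → ℝ}
    {t : Fin T} (hp : ∀ i, 0 < p t i) (i : Fin n) (z : Fin k → ℝ) :
    (V *ᵥ z) (t, i) ^ 2 ≤ p t i * coherence₂ V p t ^ 2 * (z ⬝ᵥ z) := by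
  have h := le_of_coherence (ρ := fun i => l2norm (Vᵀ *ᵥ Pi.single (t, i) 1)) hp
    (fun i => l2norm_nonneg _) (ν := coherence₂ V p t) rfl i
  refine (sq_mulVec_le_l2norm V (t, i) z).trans ?_
  exact mul_le_mul_of_nonneg_right h (by rw [← l2norm_sq]; positivity)

lemma sq_mulVec_le_coherence₃ (V : Matrix (Fin T × Fin n) (Fin k) ℝ) {p : Fin T × Fin n → ℝ}
    (hp : ∀ q, 0 < p q) (q : Fin T × Fin n) (z : Fin k → ℝ) :
    (V *ᵥ z) q ^ 2 ≤ p q * coherence₃ V p ^ 2 * (z ⬝ᵥ z) := by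
  have h := le_of_coherence (ρ := fun q => l2norm (Vᵀ *ᵥ Pi.single q 1)) hp
    (fun q => l2norm_nonneg _) (ν := coherence₃ V p) rfl q
  refine (sq_mulVec_le_l2norm V q z).trans ?_
  exact mul_le_mul_of_nonneg_right h (by rw [← l2norm_sq]; positivity)

/-- The sample size is positive, and the reweighted Gram blocks are bounded. -/
lemma block_bound {κ : Type*} {p : κ → ℝ} (hp : ∀ i, 0 < p i)
    {Q : κ → (Fin k → ℝ) → ℝ} {ν δ L : ℝ} (hδ : 0 < δ) (hL : 0 < L)
    (hQ : ∀ i z, Q i z ≤ p i * ν ^ 2 * (z ⬝ᵥ z)) (hQ0 : ∃ i z, 0 < Q i z) {m : ℕ}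
    (hm : 3 / δ ^ 2 * ν ^ 2 * L ≤ m) :
    (0 : ℝ) < m ∧ ∀ i z, 1 / (m : ℝ) / p i * Q i z ≤ δ ^ 2 / (3 * L) * (z ⬝ᵥ z) := by
  have hnn : ∀ z : Fin k → ℝ, 0 ≤ z ⬝ᵥ z := fun z => by rw [← l2norm_sq]; positivity
  have hν : 0 < ν ^ 2 := by
    obtain ⟨i, z, hiz⟩ := hQ0
    by_contra hcon
    have h0 : ν ^ 2 = 0 := le_antisymm (not_lt.1 hcon) (sq_nonneg _)
    have := hQ i z
    rw [h0] at this
    linarith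
  have hm0 : (0 : ℝ) < m := lt_of_lt_of_le (by positivity) hm
  refine ⟨hm0, fun i z => ?_⟩
  have hpi := hp i
  -- A reweighted block has norm at most ν²/m, since the probability cancels; the sample-size
  -- assumption is this inequality solved for m.
  have h1 : ν ^ 2 / m ≤ δ ^ 2 / (3 * L) := by
    rw [div_le_div_iff₀ hm0 (by positivity)]
    have := mul_le_mul_of_nonneg_left hm (sq_nonneg δ)
    calc ν ^ 2 * (3 * L) = δ ^ 2 * (3 / δ ^ 2 * ν ^ 2 * L) := by field_simp
      _ ≤ _ := this
  calc 1 / (m : ℝ) / p i * Q i z ≤ 1 / (m : ℝ) / p i * (p i * ν ^ 2 * (z ⬝ᵥ z)) :=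
        mul_le_mul_of_nonneg_left (hQ i z) (by positivity)
    _ = ν ^ 2 / m * (z ⬝ᵥ z) := by field_simp
    _ ≤ _ := mul_le_mul_of_nonneg_right h1 (hnn z)

lemma smul_div_smul {m p : ℝ} (hp : p ≠ 0) (X : Matrix (Fin k) (Fin k) ℝ) :
    p • ((1 / m / p) • X) = (1 / m) • X := by
  rw [smul_smul]; congr 1; field_simp

lemma sum_one_div_smul {m : ℕ} (hm : (0 : ℝ) < m) (X : Matrix (Fin k) (Fin k) ℝ) :
    ∑ _ : Fin m, (1 / (m : ℝ)) • X = X := by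
  rw [Finset.sum_const, Finset.card_univ, Fintype.card_fin, ← Nat.cast_smul_eq_nsmul ℝ,
    smul_smul, mul_one_div_cancel hm.ne', one_smul]

/-! ### The three sampling regimes. -/

/-- Random spatial locations at the initial time. -/
lemma errorBounds_initial (hk : 1 ≤ k) (hT : 1 ≤ T) {G : WeightedGraph n}
    (hΔt : 0 < Δt) (hU : IsEigenDecomposition G.laplacian U σ) {ε δ : ℝ}
    (hε : ε ∈ Set.Ioo (0 : ℝ) 1) (hδ : δ ∈ Set.Ioo (0 : ℝ) 1)
    {Ω : Type*} [MeasurableSpace Ω] {μ : Measure Ω} [IsProbabilityMeasure μ]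
    {p : Fin n → ℝ} {m : ℕ} {ω : Fin m → Ω → Fin n} (hp : IsPosDistribution p)
    (hω : IsIndependentDraw μ (fun _ => p) ω)
    (hm : 3 / δ ^ 2 * coherence₁ (spaceTimeBasis hkn T Δt U σ) p ^ 2 *
      Real.log (2 * k / ε) ≤ m) :
    1 - ε ≤ μ.real {w | ErrorBounds (bandlimited hkn U) (G.evolution Δt)
      (samplingMatrix₁ T fun i => ω i w)
      (sampledProb (samplingMatrix₁ T fun i => ω i w) fun q => p q.2) (weighting₁ T m)
      (2 / (√(1 - δ) * fT T (evolEigenvalue Δt σ ⟨k - 1, by omega⟩)))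
      (1 / (√(1 + δ) * fT T (evolEigenvalue Δt σ ⟨0, by omega⟩)))} := by
  have hL := log_two_mul_div_pos hk hε
  have hne := exists_spaceTimeBasis_ne_zero (Δt := Δt) (σ := σ) hkn hk hT hU.orthogonal
  have hone := sum_rowGram (Δt := Δt) (σ := σ) hkn hT hU.orthogonal
  set V := spaceTimeBasis hkn T Δt U σ
  have hquad : ∀ i z, z ⬝ᵥ ((∑ t, rowGram V (t, i)) *ᵥ z) = ∑ t, (V *ᵥ z) (t, i) ^ 2 :=
    fun i z => by simp only [Matrix.sum_mulVec, dotProduct_sum, dotProduct_rowGram]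
  have hpos : ∃ i z, 0 < ∑ t, (V *ᵥ z) (t, i) ^ 2 := by
    obtain ⟨i, z, hz⟩ := hne ⟨0, hT⟩
    exact ⟨i, z, Finset.sum_pos' (fun t _ => sq_nonneg _)
      ⟨⟨0, hT⟩, Finset.mem_univ _, sq_pos_iff.2 hz⟩⟩
  obtain ⟨hm0, hbound⟩ := block_bound (Q := fun i z => ∑ t, (V *ᵥ z) (t, i) ^ 2) hp.pos hδ.1 hL
    (sum_sq_mulVec_le_coherence₁ V hp.pos) hpos hm
  -- One draw produces T samples at the same vertex, which are not independent of each other, so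
  -- they form a single summand. This is why the coherence here is an operator norm of T rows.
  let X : Fin m → Fin n → Matrix (Fin k) (Fin k) ℝ := fun _ i =>
    (1 / (m : ℝ) / p i) • ∑ t, rowGram V (t, i)
  have hXq : ∀ j i z, z ⬝ᵥ (X j i *ᵥ z) = 1 / (m : ℝ) / p i * ∑ t, (V *ᵥ z) (t, i) ^ 2 :=
    fun j i z => by rw [dotProduct_smul_mulVec, hquad]
  have hXs : ∀ j i, (X j i).IsSymm := fun j i =>
    (isSymm_sum _ fun t => rowGram_isSymm _ _).smul _
  have hX0 : ∀ j i z, 0 ≤ z ⬝ᵥ (X j i *ᵥ z) := fun j i z => by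
    have := hp.pos i
    rw [hXq j]
    positivity
  have hXE : ∑ j, ∑ i, p i • X j i = 1 := by
    have h : ∀ j, ∑ i, p i • X j i = (1 / (m : ℝ)) • (1 : Matrix (Fin k) (Fin k) ℝ) := fun j => by
      simp only [X, smul_div_smul (hp.pos _).ne']
      rw [← Finset.smul_sum, Finset.sum_comm, hone]
    rw [Finset.sum_congr rfl fun j _ => h j, sum_one_div_smul hm0]
  have hloc : ∀ (x : Fin m → Fin n) z, z ⬝ᵥ ((∑ j, X j (x j)) *ᵥ z) =
      ∑ r : Fin T × Fin m, 1 / (m : ℝ) / p (x r.2) * (V *ᵥ z) (r.1, x r.2) ^ 2 := fun x z => by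
    simp only [Matrix.sum_mulVec, dotProduct_sum, hXq]
    rw [Fintype.sum_prod_type_right]
    exact Finset.sum_congr rfl fun j _ => Finset.mul_sum _ _ _
  exact errorBounds_probability hkn hk hT hΔt hU hε hδ hω (fun _ => hp) X hXs hX0
    (fun j i z => (hXq j i z).trans_le (hbound i z)) hXE
    (fun x (r : Fin T × Fin m) => (r.1, x r.2)) (q := fun q => p q.2) (fun q => hp.pos q.2)
    (wt := fun _ => 1 / (m : ℝ)) (fun _ => by positivity) hloc

/-- Random spatial locations at consecutive times. -/
lemma errorBounds_consecutive (hk : 1 ≤ k) (hT : 1 ≤ T) {G : WeightedGraph n}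
    (hΔt : 0 < Δt) (hU : IsEigenDecomposition G.laplacian U σ) {ε δ : ℝ}
    (hε : ε ∈ Set.Ioo (0 : ℝ) 1) (hδ : δ ∈ Set.Ioo (0 : ℝ) 1)
    {Ω : Type*} [MeasurableSpace Ω] {μ : Measure Ω} [IsProbabilityMeasure μ]
    {p : Fin T → Fin n → ℝ} {m : Fin T → ℕ} {ω : (Σ t, Fin (m t)) → Ω → Fin n}
    (hp : ∀ t, IsPosDistribution (p t)) (hω : IsIndependentDraw μ (fun r => p r.1) ω)
    (hm : ∀ t, 3 / δ ^ 2 * coherence₂ (spaceTimeBasis hkn T Δt U σ) p t ^ 2 *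
      Real.log (2 * k / ε) ≤ m t) :
    1 - ε ≤ μ.real {w | ErrorBounds (bandlimited hkn U) (G.evolution Δt)
      (samplingMatrix₂ fun r => ω r w)
      (sampledProb (samplingMatrix₂ fun r => ω r w) fun q => p q.1 q.2) (weighting₂ m)
      (2 / (√(1 - δ) * fT T (evolEigenvalue Δt σ ⟨k - 1, by omega⟩)))
      (1 / (√(1 + δ) * fT T (evolEigenvalue Δt σ ⟨0, by omega⟩)))} := by
  have hL := log_two_mul_div_pos hk hε
  have hne := exists_spaceTimeBasis_ne_zero (Δt := Δt) (σ := σ) hkn hk hT hU.orthogonal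
  have hone := sum_rowGram (Δt := Δt) (σ := σ) hkn hT hU.orthogonal
  set V := spaceTimeBasis hkn T Δt U σ
  have hb := fun t => block_bound (Q := fun i z => (V *ᵥ z) (t, i) ^ 2) (hp t).pos hδ.1 hL
    (sq_mulVec_le_coherence₂ V (hp t).pos)
    (by obtain ⟨i, z, hz⟩ := hne t; exact ⟨i, z, sq_pos_iff.2 hz⟩) (hm t)
  -- The law and the weight depend on the time of the draw. The draws at time t have total mean
  -- equal to the Gram matrix of that slice, and the identity appears only after summing over all
  -- times.
  let X : (Σ t, Fin (m t)) → Fin n → Matrix (Fin k) (Fin k) ℝ := fun r i =>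
    (1 / (m r.1 : ℝ) / p r.1 i) • rowGram V (r.1, i)
  have hXq : ∀ r i z, z ⬝ᵥ (X r i *ᵥ z) =
      1 / (m r.1 : ℝ) / p r.1 i * (V *ᵥ z) (r.1, i) ^ 2 :=
    fun r i z => by rw [dotProduct_smul_mulVec, dotProduct_rowGram]
  have hXs : ∀ r i, (X r i).IsSymm := fun r i => (rowGram_isSymm _ _).smul _
  have hX0 : ∀ r i z, 0 ≤ z ⬝ᵥ (X r i *ᵥ z) := fun r i z => by
    have := (hp r.1).pos i
    rw [hXq r]
    positivity
  have hXE : ∑ r, ∑ i, p r.1 i • X r i = 1 := by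
    simp only [X, smul_div_smul ((hp _).pos _).ne', ← Finset.smul_sum]
    rw [Fintype.sum_sigma]
    refine Eq.trans (Finset.sum_congr rfl fun t _ => ?_) hone
    exact sum_one_div_smul (hb t).1 (∑ i, rowGram V (t, i))
  have hloc : ∀ (x : (Σ t, Fin (m t)) → Fin n) z, z ⬝ᵥ ((∑ r, X r (x r)) *ᵥ z) =
      ∑ r, 1 / (m r.1 : ℝ) / p r.1 (x r) * (V *ᵥ z) (r.1, x r) ^ 2 := fun x z => by
    simp only [Matrix.sum_mulVec, dotProduct_sum, hXq]
  exact errorBounds_probability hkn hk hT hΔt hU hε hδ hω (fun r => hp r.1) X hXs hX0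
    (fun r i z => (hXq r i z).trans_le ((hb r.1).2 i z)) hXE
    (fun x (r : Σ t, Fin (m t)) => (r.1, x r)) (q := fun q => p q.1 q.2)
    (fun q => (hp q.1).pos q.2) (wt := fun r => 1 / (m r.1 : ℝ)) (fun _ => by positivity) hloc

/-- Random space-time locations. -/
lemma errorBounds_spaceTime (hk : 1 ≤ k) (hT : 1 ≤ T) {G : WeightedGraph n}
    (hΔt : 0 < Δt) (hU : IsEigenDecomposition G.laplacian U σ) {ε δ : ℝ}
    (hε : ε ∈ Set.Ioo (0 : ℝ) 1) (hδ : δ ∈ Set.Ioo (0 : ℝ) 1)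
    {Ω : Type*} [MeasurableSpace Ω] {μ : Measure Ω} [IsProbabilityMeasure μ]
    {p : Fin T × Fin n → ℝ} {m : ℕ} {ω : Fin m → Ω → Fin T × Fin n}
    (hp : IsPosDistribution p) (hω : IsIndependentDraw μ (fun _ => p) ω)
    (hm : 3 / δ ^ 2 * coherence₃ (spaceTimeBasis hkn T Δt U σ) p ^ 2 *
      Real.log (2 * k / ε) ≤ m) :
    1 - ε ≤ μ.real {w | ErrorBounds (bandlimited hkn U) (G.evolution Δt)
      (samplingMatrix₃ fun i => ω i w)
      (sampledProb (samplingMatrix₃ fun i => ω i w) p) (weighting₃ m)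
      (2 / (√(1 - δ) * fT T (evolEigenvalue Δt σ ⟨k - 1, by omega⟩)))
      (1 / (√(1 + δ) * fT T (evolEigenvalue Δt σ ⟨0, by omega⟩)))} := by
  have hL := log_two_mul_div_pos hk hε
  have hne := exists_spaceTimeBasis_ne_zero (Δt := Δt) (σ := σ) hkn hk hT hU.orthogonal
  have hone := sum_rowGram (Δt := Δt) (σ := σ) hkn hT hU.orthogonal
  set V := spaceTimeBasis hkn T Δt U σ
  have hpos : ∃ q z, 0 < (V *ᵥ z) q ^ 2 := by
    obtain ⟨i, z, hz⟩ := hne ⟨0, hT⟩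
    exact ⟨(⟨0, hT⟩, i), z, sq_pos_iff.2 hz⟩
  obtain ⟨hm0, hbound⟩ := block_bound (Q := fun q z => (V *ᵥ z) q ^ 2) hp.pos hδ.1 hL
    (sq_mulVec_le_coherence₃ V hp.pos) hpos hm
  -- Every draw picks a single row of Ũ, and its mean is already 1/m times the identity.
  let X : Fin m → Fin T × Fin n → Matrix (Fin k) (Fin k) ℝ := fun _ q =>
    (1 / (m : ℝ) / p q) • rowGram V q
  have hXq : ∀ j q z, z ⬝ᵥ (X j q *ᵥ z) = 1 / (m : ℝ) / p q * (V *ᵥ z) q ^ 2 :=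
    fun j q z => by rw [dotProduct_smul_mulVec, dotProduct_rowGram]
  have hXs : ∀ j q, (X j q).IsSymm := fun j q => (rowGram_isSymm _ _).smul _
  have hX0 : ∀ j q z, 0 ≤ z ⬝ᵥ (X j q *ᵥ z) := fun j q z => by
    have := hp.pos q
    rw [hXq j]
    positivity
  have hXE : ∑ j, ∑ q, p q • X j q = 1 := by
    have h : ∀ j, ∑ q, p q • X j q = (1 / (m : ℝ)) • (1 : Matrix (Fin k) (Fin k) ℝ) := fun j => by
      simp only [X, smul_div_smul (hp.pos _).ne']
      rw [← Finset.smul_sum, Fintype.sum_prod_type, hone]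
    rw [Finset.sum_congr rfl fun j _ => h j, sum_one_div_smul hm0]
  have hloc : ∀ (x : Fin m → Fin T × Fin n) z, z ⬝ᵥ ((∑ j, X j (x j)) *ᵥ z) =
      ∑ r, 1 / (m : ℝ) / p (x r) * (V *ᵥ z) (x r) ^ 2 := fun x z => by
    simp only [Matrix.sum_mulVec, dotProduct_sum, hXq]
  exact errorBounds_probability hkn hk hT hΔt hU hε hδ hω (fun _ => hp) X hXs hX0
    (fun j q z => (hXq j q z).trans_le (hbound q z)) hXE (fun x => x) hp.pos
    (wt := fun _ => 1 / (m : ℝ)) (fun _ => by positivity) hloc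

end Sampling

end DynSampling

theorem mainTheorem2 {n k T : ℕ} (hk : 1 ≤ k) (hkn : k ≤ n) (hT : 1 ≤ T)
    (G : DynSampling.WeightedGraph n) (hdeg : ∀ i, 0 < G.deg i)
    (Δt : ℝ) (hΔt : 0 < Δt)
    (U : Matrix (Fin n) (Fin n) ℝ) (σ : Fin n → ℝ)
    (hU : DynSampling.IsEigenDecomposition G.laplacian U σ)
    (ε δ : ℝ) (hε : ε ∈ Set.Ioo (0 : ℝ) 1) (hδ : δ ∈ Set.Ioo (0 : ℝ) 1)
    {Ω : Type*} [MeasurableSpace Ω] (μ : Measure Ω) [IsProbabilityMeasure μ] :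
    -- random spatial locations at the initial time
    (∀ (p : Fin n → ℝ) (m : ℕ) (ω : Fin m → Ω → Fin n),
      DynSampling.IsPosDistribution p →
      DynSampling.IsIndependentDraw μ (fun _ => p) ω →
      3 / δ ^ 2 * DynSampling.coherence₁ (DynSampling.spaceTimeBasis hkn T Δt U σ) p ^ 2 *
        Real.log (2 * k / ε) ≤ m →
      1 - ε ≤ μ.real {w | DynSampling.ErrorBounds (DynSampling.bandlimited hkn U)
        (G.evolution Δt)
        (DynSampling.samplingMatrix₁ T fun i => ω i w)
        (DynSampling.sampledProb (DynSampling.samplingMatrix₁ T fun i => ω i w) fun q => p q.2)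
        (DynSampling.weighting₁ T m)
        (2 / (√(1 - δ) *
          DynSampling.fT T (DynSampling.evolEigenvalue Δt σ ⟨k - 1, by omega⟩)))
        (1 / (√(1 + δ) *
          DynSampling.fT T (DynSampling.evolEigenvalue Δt σ ⟨0, by omega⟩)))}) ∧
    -- random spatial locations at consecutive times
    (∀ (p : Fin T → Fin n → ℝ) (m : Fin T → ℕ) (ω : (Σ t, Fin (m t)) → Ω → Fin n),
      (∀ t, DynSampling.IsPosDistribution (p t)) →
      DynSampling.IsIndependentDraw μ (fun r => p r.1) ω →
      (∀ t, 3 / δ ^ 2 *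
        DynSampling.coherence₂ (DynSampling.spaceTimeBasis hkn T Δt U σ) p t ^ 2 *
        Real.log (2 * k / ε) ≤ m t) →
      1 - ε ≤ μ.real {w | DynSampling.ErrorBounds (DynSampling.bandlimited hkn U)
        (G.evolution Δt)
        (DynSampling.samplingMatrix₂ fun r => ω r w)
        (DynSampling.sampledProb (DynSampling.samplingMatrix₂ fun r => ω r w)
          fun q => p q.1 q.2)
        (DynSampling.weighting₂ m)
        (2 / (√(1 - δ) *
          DynSampling.fT T (DynSampling.evolEigenvalue Δt σ ⟨k - 1, by omega⟩)))
        (1 / (√(1 + δ) *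
          DynSampling.fT T (DynSampling.evolEigenvalue Δt σ ⟨0, by omega⟩)))}) ∧
    -- random space-time locations
    (∀ (p : Fin T × Fin n → ℝ) (m : ℕ) (ω : Fin m → Ω → Fin T × Fin n),
      DynSampling.IsPosDistribution p →
      DynSampling.IsIndependentDraw μ (fun _ => p) ω →
      3 / δ ^ 2 * DynSampling.coherence₃ (DynSampling.spaceTimeBasis hkn T Δt U σ) p ^ 2 *
        Real.log (2 * k / ε) ≤ m →
      1 - ε ≤ μ.real {w | DynSampling.ErrorBounds (DynSampling.bandlimited hkn U)
        (G.evolution Δt)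
        (DynSampling.samplingMatrix₃ fun i => ω i w)
        (DynSampling.sampledProb (DynSampling.samplingMatrix₃ fun i => ω i w) p)
        (DynSampling.weighting₃ m)
        (2 / (√(1 - δ) *
          DynSampling.fT T (DynSampling.evolEigenvalue Δt σ ⟨k - 1, by omega⟩)))
        (1 / (√(1 + δ) *
          DynSampling.fT T (DynSampling.evolEigenvalue Δt σ ⟨0, by omega⟩)))}) := by
  exact ⟨fun p m ω hp hω hm => DynSampling.errorBounds_initial hkn hk hT hΔt hU hε hδ hp hω hm,
    fun p m ω hp hω hm => DynSampling.errorBounds_consecutive hkn hk hT hΔt hU hε hδ hp hω hm,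
    fun p m ω hp hω hm => DynSampling.errorBounds_spaceTime hkn hk hT hΔt hU hε hδ hp hω hm⟩
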